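/- Let $S$ be an inverse semigroup with its natural partial order ($a\le b$ iff $a=ba^{-1}a$). A minimum element, if there is one, is called zero. (If $S$ has no minimum, every element counts as nonzero.) Filters. A filter is a non-empty, upward closed subset $A\subseteq S$ such that any two elements of $A$ have a lower bound in $A$, and which does not contain zero. An ultrafilter is a filter maximal among filters; an idempotent filter is one containing an idempotent. For $a\in S$ let $\mathcal T(a)$ be the set of finite sets $X$ of elements $x\le a$ such that for every nonzero $z\le a$ there is an $x\in X$ having a common nonzero lower bound with $z$. A filter $A$ is tight if $a\in A$ and $X\in\mathcal T(a)$ imply $X\cap A\neq\emptyset$. Groupoids. Write $B^{\uparrow}$ for the upward closure of $B$, $\mathbf d(A)=(A^{-1}A)^{\uparrow}$ and $\mathbf r(A)=(AA^{-1})^{\uparrow}$. The filters form a groupoid $\mathsf G_u(S)$ under $A\cdot B=(AB)^{\uparrow}$, defined when $\mathbf d(A)=\mathbf r(B)$; it carries the patch topology, whose basis consists of the sets $$U_{x;x_1,\dots,x_n}=\{A : x\in A,\ x_1,\dots,x_n\notin A\},\qquad n\ge 0,\ x_1,\dots,x_n\le x .$$ $\mathsf G_m(S)$ is the subgroupoid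 of ultrafilters with the subspace topology, and $V_{x;x_1,\dots,x_n}=U_{x;x_1,\dots,x_n}\cap \mathsf G_m(S)$. For a groupoid $G$, $G_o$ denotes its set of identities (the elements $g g^{-1}$) with the subspace topology. Tight completion. Elements $s,t$ of an inverse semigroup are compatible if $s^{-1}t$ and $st^{-1}$ are idempotents; a set is compatible if its elements are pairwise compatible. Let $\mathbf S=S/{\equiv}$, where $a\equiv b$ iff $\mathcal T(a)\cap\mathcal T(b)\neq\emptyset$ (a congruence). Let $P$ be the set of compatible order ideals $A$ of the inverse semigroup $\mathbf S$ that are closed, meaning that $X\subseteq A$ and $X\in\mathcal T(x)$ (computed in $\mathbf S$) imply $x\in A$. With $A\cdot B=\{x : X\subseteq AB\text{ for some }X\in\mathcal T(x)\}$, $P$ is an inverse semigroup, ordered by inclusion, in which every compatible subset has a join. An element $a\in P$ is finite if whenever $a\le\bigvee Y$ with $Y\subseteq P$ compatible there is a finite $Z\subseteq Y$ with $a\le\bigvee Z$. The tight completion $\mathsf D_t(S)$ is the inverse subsemigroup of finite elements of $P$. An inverse semigroup is weakly boolean if it has joins of all finite compatible subsets, multiplication distributes over the finite joins that exist, and its semilattice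 of idempotents is a boolean algebra (a top element is not required). Then the following are equivalent: 1. $\mathsf G_m(S)$ is closed in $\mathsf G_u(S)$. 2. Every tight filter is an ultrafilter. 3. Every idempotent tight filter is an idempotent ultrafilter. 4. $\mathsf G_m(S)_o$ is closed in $\mathsf G_u(S)_o$. 5. For all $n\ge 0$ and all $x_1,\dots,x_n\le x$ in $S$, the set $V_{x;x_1,\dots,x_n}$ is compact. 6. The tight completion $\mathsf D_t(S)$ is weakly boolean. (One says that $S$ satisfies the compactness condition if these hold.) -/

import Mathlib

open scoped Pointwise

/-- An inverse semigroup: every element `a` has a unique inverse `a⁻¹`. -/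
class InverseSemigroup (S : Type*) extends Semigroup S, Inv S where
  mul_inv_mul : ∀ a : S, a * a⁻¹ * a = a
  inv_mul_inv : ∀ a : S, a⁻¹ * a * a⁻¹ = a⁻¹
  inv_unique : ∀ a b : S, a * b * a = a → b * a * b = b → b = a⁻¹

namespace InverseSemigroup

/-! ### Elementary facts, and the natural partial order -/

section Basic

variable {S : Type*} [InverseSemigroup S]

theorem inv_inv' (a : S) : a⁻¹⁻¹ = a :=
  (inv_unique a⁻¹ a (inv_mul_inv a) (mul_inv_mul a)).symm

theorem inv_of_idem {e : S} (he : IsIdempotentElem e) : e⁻¹ = e :=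
  (inv_unique e e (by rw [he.eq, he.eq]) (by rw [he.eq, he.eq])).symm

theorem idem_inv_mul (a : S) : IsIdempotentElem (a⁻¹ * a) := by
  show a⁻¹ * a * (a⁻¹ * a) = _
  rw [← mul_assoc, inv_mul_inv]

theorem idem_mul_inv (a : S) : IsIdempotentElem (a * a⁻¹) := by
  show a * a⁻¹ * (a * a⁻¹) = _
  rw [← mul_assoc, mul_inv_mul]

theorem idem_mul {e f : S} (he : IsIdempotentElem e) (hf : IsIdempotentElem f) :
    IsIdempotentElem (e * f) := by
  set x := (e * f)⁻¹ with hx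
  have h1 : e * f * x * (e * f) = e * f := mul_inv_mul _
  have h2 : x * (e * f) * x = x := inv_mul_inv _
  have he' : ∀ y, e * (e * y) = e * y := fun y => by rw [← mul_assoc, he.eq]
  have hf' : ∀ y, f * (f * y) = f * y := fun y => by rw [← mul_assoc, hf.eq]
  have h3 : f * x * e = x := by
    refine inv_unique (e * f) (f * x * e) ?_ ?_
    · simp only [mul_assoc, he', hf'] at h1 ⊢
      exact h1
    · have := congrArg (fun z => f * z * e) h2
      simp only [mul_assoc, he', hf'] at this ⊢
      exact this
  have h4 : IsIdempotentElem x := by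
    show x * x = x
    have : f * x * e * (f * x * e) = f * (x * (e * f) * x) * e := by simp only [mul_assoc]
    rw [h2, h3] at this
    exact this
  have h5 : x⁻¹ = x := inv_of_idem h4
  rw [hx, inv_inv'] at h5
  rw [h5]
  exact h4

theorem idem_comm {e f : S} (he : IsIdempotentElem e) (hf : IsIdempotentElem f) :
    e * f = f * e := by
  have h1 := (idem_mul he hf).eq
  have h2 := (idem_mul hf he).eq
  have he' : ∀ y, e * (e * y) = e * y := fun y => by rw [← mul_assoc, he.eq]
  have hf' : ∀ y, f * (f * y) = f * y := fun y => by rw [← mul_assoc, hf.eq]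
  rw [← inv_of_idem (idem_mul he hf)]
  symm
  apply inv_unique
  · simp only [mul_assoc, he', hf'] at h1 ⊢
    exact h1
  · simp only [mul_assoc, he', hf'] at h2 ⊢
    exact h2

theorem mul_inv' (a b : S) : (a * b)⁻¹ = b⁻¹ * a⁻¹ := by
  have h := idem_comm (idem_mul_inv b) (idem_inv_mul a)
  symm
  apply inv_unique
  · calc a * b * (b⁻¹ * a⁻¹) * (a * b) = a * ((b * b⁻¹) * (a⁻¹ * a)) * b := by
          simp only [mul_assoc]
      _ = (a * a⁻¹ * a) * (b * b⁻¹ * b) := by rw [h]; simp only [mul_assoc]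
      _ = a * b := by rw [mul_inv_mul, mul_inv_mul]
  · calc b⁻¹ * a⁻¹ * (a * b) * (b⁻¹ * a⁻¹) = b⁻¹ * ((a⁻¹ * a) * (b * b⁻¹)) * a⁻¹ := by
          simp only [mul_assoc]
      _ = (b⁻¹ * b * b⁻¹) * (a⁻¹ * a * a⁻¹) := by rw [← h]; simp only [mul_assoc]
      _ = b⁻¹ * a⁻¹ := by rw [inv_mul_inv, inv_mul_inv]

theorem idem_conj (b : S) {e : S} (he : IsIdempotentElem e) : IsIdempotentElem (b⁻¹ * e * b) := by
  show b⁻¹ * e * b * (b⁻¹ * e * b) = _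
  calc b⁻¹ * e * b * (b⁻¹ * e * b) = b⁻¹ * (e * (b * b⁻¹)) * e * b := by simp only [mul_assoc]
    _ = (b⁻¹ * b * b⁻¹) * (e * e) * b := by
        rw [idem_comm he (idem_mul_inv b)]; simp only [mul_assoc]
    _ = b⁻¹ * e * b := by rw [inv_mul_inv, he.eq]

theorem mul_idem_eq (b : S) {e : S} (he : IsIdempotentElem e) :
    b * e = b * ((b * e)⁻¹ * (b * e)) := by
  rw [mul_inv', inv_of_idem he]
  calc b * e = (b * b⁻¹ * b) * (e * e) := by rw [mul_inv_mul, he.eq]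
    _ = b * ((b⁻¹ * b) * e) * e := by simp only [mul_assoc]
    _ = b * (e * b⁻¹ * (b * e)) := by
        rw [idem_comm (idem_inv_mul b) he]; simp only [mul_assoc]

theorem idem_mul_eq (b : S) {e : S} (he : IsIdempotentElem e) :
    e * b = b * (b⁻¹ * e * b) := by
  calc e * b = e * (b * b⁻¹) * b := by rw [mul_assoc, mul_inv_mul]
    _ = b * (b⁻¹ * e * b) := by rw [idem_comm he (idem_mul_inv b)]; simp only [mul_assoc]

/-- The natural partial order: `a ≤ b` iff `a = b a⁻¹ a`. -/
instance naturalOrder : PartialOrder S where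
  le a b := a = b * (a⁻¹ * a)
  le_refl a := by rw [← mul_assoc, mul_inv_mul]
  le_trans a b c hab hbc := by
    have hi := idem_mul (idem_inv_mul b) (idem_inv_mul a)
    have h : a = c * ((b⁻¹ * b) * (a⁻¹ * a)) := by
      rw [← mul_assoc, ← hbc]; exact hab
    calc a = c * ((b⁻¹ * b) * (a⁻¹ * a)) := h
      _ = c * ((c * ((b⁻¹ * b) * (a⁻¹ * a)))⁻¹ * (c * ((b⁻¹ * b) * (a⁻¹ * a)))) :=
          mul_idem_eq c hi
      _ = c * (a⁻¹ * a) := by rw [← h]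
  le_antisymm a b hab hba := by
    calc a = b * (a⁻¹ * a) := hab
      _ = b * (b⁻¹ * b) * (a⁻¹ * a) := by rw [← mul_assoc b b⁻¹ b, mul_inv_mul]
      _ = b * (a⁻¹ * a) * (b⁻¹ * b) := by
          rw [mul_assoc b, idem_comm (idem_inv_mul b) (idem_inv_mul a), ← mul_assoc b]
      _ = a * (b⁻¹ * b) := by rw [← hab]
      _ = b := hba.symm

theorem le_def {a b : S} : a ≤ b ↔ a = b * (a⁻¹ * a) := Iff.rfl

theorem mul_idem_le (b : S) {e : S} (he : IsIdempotentElem e) : b * e ≤ b := mul_idem_eq b he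

theorem idem_mul_le (b : S) {e : S} (he : IsIdempotentElem e) : e * b ≤ b := by
  rw [idem_mul_eq b he]; exact mul_idem_le b (idem_conj b he)

theorem le_iff_left {a b : S} : a ≤ b ↔ a = a * a⁻¹ * b := by
  constructor
  · intro h
    have h' : a = b * (a⁻¹ * a) := h
    have h2 : b * (a⁻¹ * a) = (b⁻¹⁻¹ * (a⁻¹ * a) * b⁻¹) * b := by
      rw [inv_inv']
      calc b * (a⁻¹ * a) = b * (b⁻¹ * b) * (a⁻¹ * a) := by
            rw [← mul_assoc b b⁻¹ b, mul_inv_mul]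
        _ = b * ((a⁻¹ * a) * (b⁻¹ * b)) := by
            rw [mul_assoc b, idem_comm (idem_inv_mul b) (idem_inv_mul a)]
        _ = _ := by simp only [mul_assoc]
    have hi : IsIdempotentElem (b⁻¹⁻¹ * (a⁻¹ * a) * b⁻¹) := idem_conj b⁻¹ (idem_inv_mul a)
    set e := b⁻¹⁻¹ * (a⁻¹ * a) * b⁻¹
    have h3 : a = e * b := h'.trans h2
    calc a = e * e * (b * b⁻¹ * b) := by rw [hi.eq, mul_inv_mul]; exact h3
      _ = e * (e * (b * b⁻¹)) * b := by simp only [mul_assoc]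
      _ = e * (b * b⁻¹ * e) * b := by rw [idem_comm hi (idem_mul_inv b)]
      _ = a * a⁻¹ * b := by
          rw [h3, mul_inv', inv_of_idem hi]; simp only [mul_assoc]
  · intro h
    rw [h]; exact idem_mul_le b (idem_mul_inv a)

theorem inv_le_inv' {a b : S} (h : a ≤ b) : a⁻¹ ≤ b⁻¹ := by
  rw [le_iff_left] at h
  have := congrArg (·⁻¹) h
  simp only [mul_inv', inv_inv'] at this
  rw [le_def, inv_inv']
  exact this

theorem mul_le_mul_left'' {a b : S} (h : a ≤ b) (c : S) : c * a ≤ c * b := by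
  have h' : a = b * (a⁻¹ * a) := h
  have : c * a = c * b * (a⁻¹ * a) := by rw [mul_assoc]; exact congrArg (c * ·) h'
  rw [this]; exact mul_idem_le _ (idem_inv_mul a)

theorem mul_le_mul_right'' {a b : S} (h : a ≤ b) (c : S) : a * c ≤ b * c := by
  have h' := le_iff_left.1 h
  have : a * c = a * a⁻¹ * (b * c) := by rw [← mul_assoc]; exact congrArg (· * c) h'
  rw [this]; exact idem_mul_le _ (idem_mul_inv a)

theorem mul_le_mul'' {a b c d : S} (h : a ≤ b) (h' : c ≤ d) : a * c ≤ b * d :=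
  (mul_le_mul_right'' h c).trans (mul_le_mul_left'' h' b)

theorem idem_of_le {a e : S} (h : a ≤ e) (he : IsIdempotentElem e) : IsIdempotentElem a := by
  rw [le_def.1 h]; exact idem_mul he (idem_inv_mul a)

theorem le_mul_dom {v x y : S} (hx : v ≤ x) (hy : v ≤ y) : v ≤ x * (y⁻¹ * y) := by
  have h1 : v⁻¹ * v ≤ y⁻¹ * y := mul_le_mul'' (inv_le_inv' hy) hy
  have h2 := mul_le_mul_left'' h1 x
  rwa [← le_def.1 hx] at h2

theorem mul_dom_le {x y a : S} (hx : x ≤ a) (hy : y ≤ a) : x * (y⁻¹ * y) ≤ y := by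
  have h : x * (y⁻¹ * y) ≤ a * (y⁻¹ * y) := mul_le_mul_right'' hx _
  rwa [← le_def.1 hy] at h

/-- A left or right multiple of the zero (the minimum element) is again the zero. -/
theorem isBot_mul_left {w : S} (h : IsBot w) (s : S) : IsBot (s * w) := fun b =>
  (mul_le_mul_left'' (h (s⁻¹ * b)) s).trans (by
    rw [← mul_assoc]; exact idem_mul_le b (idem_mul_inv s))

theorem isBot_mul_right {w : S} (h : IsBot w) (s : S) : IsBot (w * s) := fun b =>
  (mul_le_mul_right'' (h (b * s⁻¹)) s).trans (by
    rw [mul_assoc]; exact mul_idem_le b (idem_inv_mul s))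

/-- Two elements are compatible if `s⁻¹ t` and `s t⁻¹` are idempotents. -/
def Compatible (s t : S) : Prop :=
  IsIdempotentElem (s⁻¹ * t) ∧ IsIdempotentElem (s * t⁻¹)

theorem Compatible.of_le {s t a : S} (hs : s ≤ a) (ht : t ≤ a) : Compatible s t :=
  ⟨idem_of_le (mul_le_mul'' (inv_le_inv' hs) ht) (idem_inv_mul a),
    idem_of_le (mul_le_mul'' hs (inv_le_inv' ht)) (idem_mul_inv a)⟩

theorem Compatible.mono {s t s' t' : S} (h : Compatible s t) (hs : s' ≤ s) (ht : t' ≤ t) :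
    Compatible s' t' :=
  ⟨idem_of_le (mul_le_mul'' (inv_le_inv' hs) ht) h.1,
    idem_of_le (mul_le_mul'' hs (inv_le_inv' ht)) h.2⟩

/-- A subset is compatible if its elements are pairwise compatible. -/
def CompatibleSet (X : Set S) : Prop := ∀ s ∈ X, ∀ t ∈ X, Compatible s t

end Basic

/-- A regular semigroup with commuting idempotents is an inverse semigroup. -/
abbrev ofCommute (T : Type*) [Semigroup T] [Inv T]
    (h1 : ∀ a : T, a * a⁻¹ * a = a) (h2 : ∀ a : T, a⁻¹ * a * a⁻¹ = a⁻¹)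
    (hc : ∀ e f : T, IsIdempotentElem e → IsIdempotentElem f → e * f = f * e) :
    InverseSemigroup T where
  mul_inv_mul := h1
  inv_mul_inv := h2
  inv_unique a b hab hba := by
    have i1 : IsIdempotentElem (b * a) := by
      show b * a * (b * a) = b * a
      rw [← mul_assoc, hba]
    have i2 : IsIdempotentElem (a⁻¹ * a) := by
      show a⁻¹ * a * (a⁻¹ * a) = _
      rw [← mul_assoc, h2]
    have i3 : IsIdempotentElem (a * b) := by
      show a * b * (a * b) = a * b
      rw [← mul_assoc, hab]
    have i4 : IsIdempotentElem (a * a⁻¹) := by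
      show a * a⁻¹ * (a * a⁻¹) = _
      rw [← mul_assoc, h1]
    have e1 : b * a = a⁻¹ * a := by
      calc b * a = b * a * (a⁻¹ * a) := by rw [mul_assoc b, ← mul_assoc a, h1]
        _ = a⁻¹ * a * (b * a) := hc _ _ i1 i2
        _ = a⁻¹ * (a * b * a) := by simp only [mul_assoc]
        _ = a⁻¹ * a := by rw [hab]
    have e2 : a * b = a * a⁻¹ := by
      calc a * b = a * a⁻¹ * (a * b) := by rw [← mul_assoc, h1]
        _ = a * b * (a * a⁻¹) := hc _ _ i4 i3
        _ = (a * b * a) * a⁻¹ := by simp only [mul_assoc]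
        _ = a * a⁻¹ := by rw [hab]
    calc b = b * a * b := hba.symm
      _ = a⁻¹ * (a * b) := by rw [e1, mul_assoc]
      _ = a⁻¹ := by rw [e2, ← mul_assoc, h2]

/-! ### Weakly boolean inverse semigroups -/

/-- An inverse semigroup is distributive if every finite compatible subset (the empty one
included) has a join and multiplication distributes over the finite joins that exist. -/
def IsDistributive (D : Type*) [InverseSemigroup D] : Prop :=
  (∀ X : Set D, X.Finite → CompatibleSet X → ∃ j, IsLUB X j) ∧
    ∀ X : Set D, X.Finite → ∀ j, IsLUB X j → ∀ s : D,
      IsLUB ((fun x => s * x) '' X) (s * j) ∧ IsLUB ((fun x => x * s) '' X) (j * s)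

/-- The semilattice of idempotents (ordered by the natural partial order) is a boolean algebra.
As boolean algebras are not required to have a top element here, this is Mathlib's
`GeneralizedBooleanAlgebra`. -/
def IdempotentsBoolean (D : Type*) [InverseSemigroup D] : Prop :=
  ∃ B : GeneralizedBooleanAlgebra {e : D // IsIdempotentElem e},
    ∀ e f : {e : D // IsIdempotentElem e}, B.le e f ↔ (e : D) ≤ (f : D)

/-- A weakly boolean inverse semigroup: distributive, with a boolean algebra of idempotents. -/
def IsWeaklyBoolean (D : Type*) [InverseSemigroup D] : Prop :=
  IsDistributive D ∧ IdempotentsBoolean D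

/-! ### The tight coverage

The zero of a poset is its minimum element; `IsBot x` says that `x` is the zero. In an inverse
semigroup without a minimum every element is nonzero. -/

section Coverage

variable {S : Type*} [InverseSemigroup S]

/-- `a → B`: every nonzero `x ≤ a` has a common nonzero lower bound with some `b ∈ B`. -/
def Arrow (a : S) (B : Set S) : Prop :=
  ∀ x ≤ a, ¬ IsBot x → ∃ b ∈ B, ∃ y, ¬ IsBot y ∧ y ≤ x ∧ y ≤ b

/-- The tight coverings of `a`: finite subsets `B` of the principal order ideal of `a` such that
`a → B`. -/
def tightCover (a : S) : Set (Set S) :=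
  {B | B.Finite ∧ (∀ b ∈ B, b ≤ a) ∧ Arrow a B}

theorem tightCover_singleton (a : S) : {a} ∈ tightCover a :=
  ⟨Set.finite_singleton a, fun _ hb => (Set.mem_singleton_iff.1 hb).le,
    fun x hx h0 => ⟨a, rfl, x, h0, le_rfl, hx⟩⟩

theorem tightCover_inv {a : S} {X : Set S} (h : X ∈ tightCover a) :
    (fun x => x⁻¹) '' X ∈ tightCover a⁻¹ := by
  have hb : ∀ z : S, ¬ IsBot z → ¬ IsBot z⁻¹ := fun _ hz h0 => hz fun c => by
    have := inv_le_inv' (h0 c⁻¹)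
    rwa [inv_inv', inv_inv'] at this
  obtain ⟨hf, hl, ha⟩ := h
  refine ⟨hf.image _, ?_, ?_⟩
  · rintro _ ⟨x, hx, rfl⟩
    exact inv_le_inv' (hl x hx)
  · intro x hx h0
    have hx' := inv_le_inv' hx
    rw [inv_inv'] at hx'
    obtain ⟨b, hbX, y, hy0, hyx, hyb⟩ := ha x⁻¹ hx' (hb x h0)
    refine ⟨b⁻¹, ⟨b, hbX, rfl⟩, y⁻¹, hb y hy0, ?_, inv_le_inv' hyb⟩
    have := inv_le_inv' hyx
    rwa [inv_inv'] at this

theorem tightCover_mul_left {a : S} {X : Set S} (h : X ∈ tightCover a) (s : S) :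
    (fun x => s * x) '' X ∈ tightCover (s * a) := by
  obtain ⟨hf, hl, ha⟩ := h
  refine ⟨hf.image _, ?_, ?_⟩
  · rintro _ ⟨x, hx, rfl⟩
    exact mul_le_mul_left'' (hl x hx) s
  · intro z hz h0
    have hz1 : s * (s⁻¹ * z) = z := by
      have h := le_def.1 hz
      calc s * (s⁻¹ * z) = s * s⁻¹ * s * (a * (z⁻¹ * z)) := by
            conv_lhs => rw [h]
            simp only [mul_assoc]
        _ = z := by rw [mul_inv_mul, ← mul_assoc, ← h]
    have hz2 : s⁻¹ * z ≤ a := by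
      refine (mul_le_mul_left'' hz s⁻¹).trans ?_
      rw [← mul_assoc]
      exact idem_mul_le a (idem_inv_mul s)
    obtain ⟨b, hb, y, hy0, hyz, hyb⟩ := ha _ hz2 fun hbot => h0 (hz1 ▸ isBot_mul_left hbot s)
    refine ⟨s * b, ⟨b, hb, rfl⟩, s * y, ?_, ?_, mul_le_mul_left'' hyb s⟩
    · intro hbot
      apply hy0
      have hy1 : s⁻¹ * (s * y) = y := by
        have h := le_def.1 hyz
        calc s⁻¹ * (s * y) = s⁻¹ * s * s⁻¹ * (z * (y⁻¹ * y)) := by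
              conv_lhs => rw [h]
              simp only [mul_assoc]
          _ = y := by rw [inv_mul_inv, ← mul_assoc, ← h]
      exact hy1 ▸ isBot_mul_left hbot s⁻¹
    · have := mul_le_mul_left'' hyz s
      rwa [hz1] at this

theorem tightCover_mul_right {a : S} {X : Set S} (h : X ∈ tightCover a) (s : S) :
    (fun x => x * s) '' X ∈ tightCover (a * s) := by
  have := tightCover_inv (tightCover_mul_left (tightCover_inv h) s⁻¹)
  rw [mul_inv', inv_inv', inv_inv', Set.image_image, Set.image_image] at this
  simpa only [mul_inv', inv_inv'] using this

theorem tightCover_trans {a : S} {X : Set S} (h : X ∈ tightCover a) (Y : S → Set S)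
    (hY : ∀ x ∈ X, Y x ∈ tightCover x) : (⋃ x ∈ X, Y x) ∈ tightCover a := by
  obtain ⟨hf, hl, ha⟩ := h
  refine ⟨hf.biUnion fun x hx => (hY x hx).1, ?_, ?_⟩
  · intro b hb
    simp only [Set.mem_iUnion] at hb
    obtain ⟨x, hx, hb⟩ := hb
    exact ((hY x hx).2.1 b hb).trans (hl x hx)
  · intro z hz h0
    obtain ⟨x, hx, y, hy0, hyz, hyx⟩ := ha z hz h0
    obtain ⟨b, hb, v, hv0, hvy, hvb⟩ := (hY x hx).2.2 y hyx hy0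
    exact ⟨b, by simp only [Set.mem_iUnion]; exact ⟨x, hx, hb⟩, v, hv0, hvy.trans hyz, hvb⟩

theorem tightCover_mul {a b : S} {X Y : Set S} (hX : X ∈ tightCover a) (hY : Y ∈ tightCover b) :
    X * Y ∈ tightCover (a * b) := by
  classical
  have h1 := tightCover_mul_right hX b
  choose! f hf using fun z (hz : z ∈ (fun x => x * b) '' X) => hz
  have := tightCover_trans h1 (fun z => (fun y => f z * y) '' Y) fun z hz => by
    have := tightCover_mul_left hY (f z)
    rwa [show f z * b = z from (hf z hz).2] at this
  refine ⟨hX.1.mul hY.1, ?_, ?_⟩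
  · rintro _ ⟨x, hx, y, hy, rfl⟩
    exact mul_le_mul'' (hX.2.1 x hx) (hY.2.1 y hy)
  · intro z hz h0
    obtain ⟨c, hc, y, hy⟩ := this.2.2 z hz h0
    simp only [Set.mem_iUnion] at hc
    obtain ⟨w, hw, v, hv, rfl⟩ := hc
    exact ⟨f w * v, ⟨f w, (hf w hw).1, v, hv, rfl⟩, y, hy⟩

/-- The relation `a ≡ b`: the elements `a` and `b` have a common tight covering. -/
def TightEquiv (a b : S) : Prop := (tightCover a ∩ tightCover b).Nonempty

theorem tightCover_meet {a b : S} {X Y : Set S} (hX : X ∈ tightCover a) (hXb : ∀ x ∈ X, x ≤ b)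
    (hY : Y ∈ tightCover b) : Set.image2 (fun x y => x * (y⁻¹ * y)) X Y ∈ tightCover a := by
  refine ⟨hX.1.image2 _ hY.1, ?_, ?_⟩
  · rintro _ ⟨x, hx, y, hy, rfl⟩
    exact (mul_idem_le x (idem_inv_mul y)).trans (hX.2.1 x hx)
  · intro z hz h0
    obtain ⟨x, hx, u, hu0, huz, hux⟩ := hX.2.2 z hz h0
    obtain ⟨y, hy, v, hv0, hvu, hvy⟩ := hY.2.2 u (hux.trans (hXb x hx)) hu0
    exact ⟨_, ⟨x, hx, y, hy, rfl⟩, v, hv0, hvu.trans huz, le_mul_dom (hvu.trans hux) hvy⟩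

theorem mul_dom_comm {x y b : S} (hx : x ≤ b) (hy : y ≤ b) :
    x * (y⁻¹ * y) = y * (x⁻¹ * x) :=
  le_antisymm (le_mul_dom (mul_dom_le hx hy) (mul_idem_le x (idem_inv_mul y)))
    (le_mul_dom (mul_dom_le hy hx) (mul_idem_le y (idem_inv_mul x)))

theorem TightEquiv.trans {a b c : S} (h : TightEquiv a b) (h' : TightEquiv b c) :
    TightEquiv a c := by
  obtain ⟨X, hXa, hXb⟩ := h
  obtain ⟨Y, hYb, hYc⟩ := h'
  refine ⟨_, tightCover_meet hXa hXb.2.1 hYb, ?_⟩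
  have := tightCover_meet hYc hYb.2.1 hXb
  rw [Set.image2_swap] at this
  convert this using 1
  ext z
  constructor
  · rintro ⟨x, hx, y, hy, rfl⟩
    exact ⟨x, hx, y, hy, (mul_dom_comm (hXb.2.1 x hx) (hYb.2.1 y hy)).symm⟩
  · rintro ⟨x, hx, y, hy, rfl⟩
    exact ⟨x, hx, y, hy, mul_dom_comm (hXb.2.1 x hx) (hYb.2.1 y hy)⟩

variable (S) in
/-- The relation `≡` is a congruence. -/
def tightCon : Con S where
  r := TightEquiv
  iseqv :=
    ⟨fun a => ⟨{a}, tightCover_singleton a, tightCover_singleton a⟩,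
      fun ⟨X, h, h'⟩ => ⟨X, h', h⟩, TightEquiv.trans⟩
  mul' := fun ⟨X, h1, h2⟩ ⟨Y, h3, h4⟩ => ⟨X * Y, tightCover_mul h1 h3, tightCover_mul h2 h4⟩

variable (S) in
/-- The quotient of `S` by the congruence `≡`. -/
def TightQuotient : Type _ := (tightCon S).Quotient

instance : Semigroup (TightQuotient S) := inferInstanceAs (Semigroup (tightCon S).Quotient)

/-- The quotient homomorphism. -/
def tightMk : S →ₙ* TightQuotient S where
  toFun a := ((a : (tightCon S).Quotient) : TightQuotient S)
  map_mul' _ _ := rfl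

theorem tightMk_surjective : Function.Surjective (tightMk (S := S)) :=
  Quotient.mk''_surjective

theorem tightMk_eq {a b : S} : tightMk a = tightMk b ↔ TightEquiv a b := (tightCon S).eq

instance : Inv (TightQuotient S) where
  inv := Quotient.map' (fun a => a⁻¹) fun _ _ ⟨_, h, h'⟩ =>
    ⟨_, tightCover_inv h, tightCover_inv h'⟩

theorem tightMk_inv (a : S) : tightMk a⁻¹ = (tightMk a)⁻¹ := rfl

theorem exists_idem_lift {e : TightQuotient S} (he : IsIdempotentElem e) :
    ∃ f : S, IsIdempotentElem f ∧ tightMk f = e := by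
  obtain ⟨x, rfl⟩ := tightMk_surjective e
  have hx : tightMk (x * x) = tightMk x := by rw [map_mul]; exact he
  have h1 : x * x * (x * x)⁻¹ * (x * x) = x * x := mul_inv_mul _
  have h2 : (x * x)⁻¹ * (x * x) * (x * x)⁻¹ = (x * x)⁻¹ := inv_mul_inv _
  refine ⟨x * (x * x)⁻¹ * x, ?_, ?_⟩
  · show x * (x * x)⁻¹ * x * (x * (x * x)⁻¹ * x) = _
    calc x * (x * x)⁻¹ * x * (x * (x * x)⁻¹ * x)
        = x * ((x * x)⁻¹ * (x * x) * (x * x)⁻¹) * x := by simp only [mul_assoc]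
      _ = _ := by rw [h2]
  · have := congrArg tightMk h1
    rw [map_mul, map_mul, hx] at this
    rw [map_mul, map_mul]
    exact this

instance : InverseSemigroup (TightQuotient S) :=
  ofCommute (TightQuotient S)
    (fun a => by
      obtain ⟨x, rfl⟩ := tightMk_surjective a
      rw [← tightMk_inv, ← map_mul, ← map_mul, mul_inv_mul])
    (fun a => by
      obtain ⟨x, rfl⟩ := tightMk_surjective a
      rw [← tightMk_inv, ← map_mul, ← map_mul, inv_mul_inv])
    (fun e f he hf => by
      obtain ⟨x, hx, rfl⟩ := exists_idem_lift he
      obtain ⟨y, hy, rfl⟩ := exists_idem_lift hf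
      rw [← map_mul, ← map_mul, idem_comm hx hy])

variable (S) in
/-- An inverse semigroup is separative (with respect to the tight coverage) if elements with a
common tight covering are equal. -/
class TightSeparative : Prop where
  eq_of_cover : ∀ (a b : S) (X : Set S), X ∈ tightCover a → X ∈ tightCover b → a = b

theorem tightMk_mono {a b : S} (h : a ≤ b) : tightMk a ≤ tightMk b := by
  rw [le_def, ← tightMk_inv, ← map_mul, ← map_mul, ← le_def.1 h]

theorem isBot_tightMk {a : S} (h : IsBot a) : IsBot (tightMk a) := fun b => by
  obtain ⟨b, rfl⟩ := tightMk_surjective b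
  exact tightMk_mono (h b)

theorem isBot_of_tightMk {z a : S} (hz : IsBot z) (h : IsBot (tightMk a)) : IsBot a := by
  obtain ⟨X, hX, hX'⟩ := tightMk_eq.1 (le_antisymm (h (tightMk z)) (isBot_tightMk hz (tightMk a)))
  by_contra h0
  obtain ⟨b, hb, y, hy0, -, hyb⟩ := hX.2.2 a le_rfl h0
  exact hy0 fun c => (hyb.trans (hX'.2.1 b hb)).trans (hz c)

theorem tightCover_lift {z a : S} (hz : IsBot z) {X : Set (TightQuotient S)}
    (hX : X ∈ tightCover (tightMk a)) (e : TightQuotient S → S)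
    (he : ∀ x ∈ X, IsIdempotentElem (e x) ∧ tightMk (e x) = x⁻¹ * x) :
    (fun x => a * e x) '' X ∈ tightCover a := by
  refine ⟨hX.1.image _, ?_, ?_⟩
  · rintro _ ⟨x, hx, rfl⟩
    exact mul_idem_le a (he x hx).1
  · intro w hw h0
    obtain ⟨x, hx, u, hu0, huw, hux⟩ :=
      hX.2.2 _ (tightMk_mono hw) fun h => h0 (isBot_of_tightMk hz h)
    obtain ⟨f, hf, hfu⟩ := exists_idem_lift (idem_inv_mul u)
    have hσ : tightMk (w * e x * f) = u := by
      rw [map_mul, map_mul, (he x hx).2, hfu]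
      have h1 : x⁻¹ * x * (u⁻¹ * u) = u⁻¹ * u := by
        have h : u⁻¹ * u ≤ x⁻¹ * x := mul_le_mul'' (inv_le_inv' hux) hux
        have h2 := le_def.1 h
        rw [inv_of_idem (idem_inv_mul u), (idem_inv_mul u).eq] at h2
        exact h2.symm
      rw [mul_assoc, h1, ← le_def.1 huw]
    refine ⟨a * e x, ⟨x, hx, rfl⟩, w * e x * f, ?_, ?_, ?_⟩
    · intro hb
      exact hu0 (hσ ▸ isBot_tightMk hb)
    · exact (mul_idem_le _ hf).trans (mul_idem_le _ (he x hx).1)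
    · exact (mul_idem_le _ hf).trans (mul_le_mul_right'' hw _)

instance : TightSeparative (TightQuotient S) where
  eq_of_cover a b X hXa hXb := by
    obtain ⟨a, rfl⟩ := tightMk_surjective a
    obtain ⟨b, rfl⟩ := tightMk_surjective b
    by_cases hS : ∃ z : S, IsBot z
    · obtain ⟨z, hz⟩ := hS
      have : Nonempty S := ⟨z⟩
      choose! e he using fun (x : TightQuotient S) (_ : x ∈ X) =>
        exists_idem_lift (idem_inv_mul x)
      have hax : ∀ x ∈ X, tightMk (a * e x) = x := fun x hx => by
        rw [map_mul, (he x hx).2, ← le_def.1 (hXa.2.1 x hx)]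
      have hbx : ∀ x ∈ X, tightMk (b * e x) = x := fun x hx => by
        rw [map_mul, (he x hx).2, ← le_def.1 (hXb.2.1 x hx)]
      choose! C hCa hCb using fun x (hx : x ∈ X) =>
        tightMk_eq.1 ((hax x hx).trans (hbx x hx).symm)
      have h1 := tightCover_trans (tightCover_lift hz hXa e he) (fun z => C (tightMk z)) (by
        rintro _ ⟨x, hx, rfl⟩
        simp only [hax x hx]
        exact hCa x hx)
      have h2 := tightCover_trans (tightCover_lift hz hXb e he) (fun z => C (tightMk z)) (by
        rintro _ ⟨x, hx, rfl⟩
        simp only [hbx x hx]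
        exact hCb x hx)
      refine tightMk_eq.2 ⟨_, h1, ?_⟩
      convert h2 using 1
      ext c
      simp only [Set.mem_iUnion, Set.mem_image, exists_prop]
      constructor
      · rintro ⟨_, ⟨x, hx, rfl⟩, hc⟩
        exact ⟨_, ⟨x, hx, rfl⟩, by rw [hbx x hx]; rwa [hax x hx] at hc⟩
      · rintro ⟨_, ⟨x, hx, rfl⟩, hc⟩
        exact ⟨_, ⟨x, hx, rfl⟩, by rw [hax x hx]; rwa [hbx x hx] at hc⟩
    · have hS' : ∀ z : S, ¬ IsBot z := fun z hz => hS ⟨z, hz⟩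
      have key : ∀ (x : TightQuotient S) (c : S), x ≤ tightMk c → x = tightMk c := by
        intro x c hx
        obtain ⟨f, hf, hfx⟩ := exists_idem_lift (idem_inv_mul x)
        rw [le_def.1 hx, ← hfx, ← map_mul]
        refine tightMk_eq.2 ⟨{c * f}, tightCover_singleton _, Set.finite_singleton _, ?_, ?_⟩
        · intro y hy
          rw [Set.mem_singleton_iff.1 hy]
          exact mul_idem_le c hf
        · intro y hy _
          exact ⟨_, rfl, y * f, hS' _, mul_idem_le y hf, mul_le_mul_right'' hy f⟩
      rcases X.eq_empty_or_nonempty with rfl | ⟨x, hx⟩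
      · have hbot : ∀ c : TightQuotient S, ∅ ∈ tightCover c → IsBot c := fun c hc => by
          by_contra h0
          obtain ⟨b, hb, -⟩ := hc.2.2 c le_rfl h0
          exact hb
        exact le_antisymm (hbot _ hXa _) (hbot _ hXb _)
      · rw [← key x a (hXa.2.1 x hx), ← key x b (hXb.2.1 x hx)]

end Coverage

/-! ### The pseudogroup of tightly closed compatible order ideals -/

section Ideals

variable {R : Type*} [InverseSemigroup R]

/-- The closure of a subset `A`: all elements having a tight covering contained in `A`. -/
def tightClosure (A : Set R) : Set R := {x | ∃ X ⊆ A, X ∈ tightCover x}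

theorem subset_tightClosure (A : Set R) : A ⊆ tightClosure A := fun a ha =>
  ⟨{a}, Set.singleton_subset_iff.2 ha, tightCover_singleton a⟩

theorem tightClosure_mono {A B : Set R} (h : A ⊆ B) : tightClosure A ⊆ tightClosure B :=
  fun _ ⟨X, hX, hx⟩ => ⟨X, hX.trans h, hx⟩

theorem mem_tightClosure_of_cover {A X : Set R} {a : R} (hX : X ⊆ tightClosure A)
    (ha : X ∈ tightCover a) : a ∈ tightClosure A := by
  choose! Y hYA hY using fun x (hx : x ∈ X) => hX hx
  exact ⟨_, Set.iUnion₂_subset hYA, tightCover_trans ha Y hY⟩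

theorem tightClosure_mul_left {A B : Set R} {a b : R} (ha : a ∈ A) (hb : b ∈ tightClosure B) :
    a * b ∈ tightClosure (A * B) := by
  obtain ⟨X, hXB, hX⟩ := hb
  exact ⟨_, Set.image_subset_iff.2 fun x hx => Set.mul_mem_mul ha (hXB hx),
    tightCover_mul_left hX a⟩

theorem tightClosure_mul_right {A B : Set R} {a b : R} (ha : a ∈ tightClosure A) (hb : b ∈ B) :
    a * b ∈ tightClosure (A * B) := by
  obtain ⟨X, hXA, hX⟩ := ha
  exact ⟨_, Set.image_subset_iff.2 fun x hx => Set.mul_mem_mul (hXA hx) hb,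
    tightCover_mul_right hX b⟩

theorem tightClosure_lower {A : Set R} (hA : ∀ a ∈ A, ∀ b ≤ a, b ∈ A) :
    ∀ a ∈ tightClosure A, ∀ b ≤ a, b ∈ tightClosure A := by
  rintro a ⟨X, hXA, hX⟩ b hb
  have h := tightCover_mul_right hX (b⁻¹ * b)
  rw [← le_def.1 hb] at h
  refine ⟨_, ?_, h⟩
  rintro _ ⟨x, hx, rfl⟩
  exact hA x (hXA hx) _ (mul_idem_le x (idem_inv_mul b))

/-- The tight coverage of a separative semigroup is idempotent-pure. -/
theorem idem_of_cover [TightSeparative R] {X : Set R} {a : R} (hX : X ∈ tightCover a)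
    (h : ∀ x ∈ X, IsIdempotentElem x) : IsIdempotentElem a := by
  have h1 := tightCover_mul_right hX a⁻¹
  have h2 : (fun x => x * a⁻¹) '' X = X := by
    have : ∀ x ∈ X, x * a⁻¹ = x := fun x hx => by
      have h3 := inv_le_inv' (hX.2.1 x hx)
      rw [inv_of_idem (h x hx)] at h3
      have h4 := le_iff_left.1 h3
      rw [inv_of_idem (h x hx), (h x hx).eq] at h4
      exact h4.symm
    rw [Set.image_congr this, Set.image_id']
  rw [h2] at h1
  rw [TightSeparative.eq_of_cover _ _ X hX h1]
  exact idem_mul_inv a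

theorem tightClosure_compatible [TightSeparative R] {A : Set R} (hA : CompatibleSet A) :
    CompatibleSet (tightClosure A) := by
  rintro a ⟨X, hXA, hX⟩ b ⟨Y, hYA, hY⟩
  constructor
  · refine idem_of_cover (tightCover_mul (tightCover_inv hX) hY) ?_
    rintro _ ⟨_, ⟨x, hx, rfl⟩, y, hy, rfl⟩
    exact (hA x (hXA hx) y (hYA hy)).1
  · refine idem_of_cover (tightCover_mul hX (tightCover_inv hY)) ?_
    rintro _ ⟨x, hx, _, ⟨y, hy, rfl⟩, rfl⟩
    exact (hA x (hXA hx) y (hYA hy)).2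

variable (R) in
/-- The compatible order ideals of `R` that are closed for the tight coverage. -/
@[ext] structure TightIdeal where
  carrier : Set R
  lower' : ∀ a ∈ carrier, ∀ b ≤ a, b ∈ carrier
  compat' : CompatibleSet carrier
  closed' : ∀ (a : R) (X : Set R), X ⊆ carrier → X ∈ tightCover a → a ∈ carrier

namespace TightIdeal

theorem closure_subset (A : TightIdeal R) {B : Set R} (h : B ⊆ A.carrier) :
    tightClosure B ⊆ A.carrier := fun _ ⟨X, hX, hx⟩ => A.closed' _ X (hX.trans h) hx

/-- The inverse of a closed ideal is the set of inverses of its elements. -/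
instance : Inv (TightIdeal R) where
  inv A :=
    { carrier := {a | a⁻¹ ∈ A.carrier}
      lower' := fun a ha b hb => A.lower' _ ha _ (inv_le_inv' hb)
      compat' := fun a ha b hb => by
        have h := A.compat' _ ha _ hb
        unfold Compatible at h ⊢
        rw [inv_inv', inv_inv'] at h
        exact ⟨h.2, h.1⟩
      closed' := fun a X hX ha => A.closed' a⁻¹ _ (Set.image_subset_iff.2 hX) (tightCover_inv ha) }

theorem mem_inv {A : TightIdeal R} {a : R} : a ∈ (A⁻¹).carrier ↔ a⁻¹ ∈ A.carrier := Iff.rfl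

theorem inv_inv_ideal (A : TightIdeal R) : A⁻¹⁻¹ = A := by
  ext a
  rw [mem_inv, mem_inv, inv_inv']

variable [TightSeparative R]

/-- The closure of a compatible order ideal. -/
def closure (A : Set R) (h : ∀ a ∈ A, ∀ b ≤ a, b ∈ A) (hc : CompatibleSet A) : TightIdeal R where
  carrier := tightClosure A
  lower' := tightClosure_lower h
  compat' := tightClosure_compatible hc
  closed' _ _ := mem_tightClosure_of_cover

/-- The product of two closed ideals is the closure of their subset product. -/
instance : Mul (TightIdeal R) where
  mul A B := closure (A.carrier * B.carrier)
    (by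
      rintro _ ⟨a, ha, b, hb, rfl⟩ c hc
      exact ⟨a, ha, b * (c⁻¹ * c), B.lower' b hb _ (mul_idem_le b (idem_inv_mul c)), by
        show a * (b * (c⁻¹ * c)) = c
        rw [← mul_assoc]; exact (le_def.1 hc).symm⟩)
    (by
      rintro _ ⟨a, ha, b, hb, rfl⟩ _ ⟨c, hc, d, hd, rfl⟩
      constructor
      · have h1 : (a * b)⁻¹ * (c * d) ≤ b⁻¹ * d := by
          rw [mul_inv']
          calc b⁻¹ * a⁻¹ * (c * d) = b⁻¹ * ((a⁻¹ * c) * d) := by simp only [mul_assoc]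
            _ ≤ b⁻¹ * d := mul_le_mul_left'' (idem_mul_le d (A.compat' a ha c hc).1) _
        exact idem_of_le h1 (B.compat' b hb d hd).1
      · have h1 : a * b * (c * d)⁻¹ ≤ a * c⁻¹ := by
          rw [mul_inv']
          calc a * b * (d⁻¹ * c⁻¹) = a * (b * d⁻¹) * c⁻¹ := by simp only [mul_assoc]
            _ ≤ a * c⁻¹ := mul_le_mul_right'' (mul_idem_le a (B.compat' b hb d hd).2) _
        exact idem_of_le h1 (A.compat' a ha c hc).2)

theorem mul_carrier (A B : TightIdeal R) :
    (A * B).carrier = tightClosure (A.carrier * B.carrier) := rfl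

theorem mem_mul {A B : TightIdeal R} {a b : R} (ha : a ∈ A.carrier) (hb : b ∈ B.carrier) :
    a * b ∈ (A * B).carrier := subset_tightClosure _ (Set.mul_mem_mul ha hb)

theorem mul_subset {A B C : TightIdeal R}
    (h : ∀ a ∈ A.carrier, ∀ b ∈ B.carrier, a * b ∈ C.carrier) : (A * B).carrier ⊆ C.carrier :=
  C.closure_subset (Set.mul_subset_iff.2 h)

theorem mul_mul_subset {A B C D : TightIdeal R}
    (h : ∀ a ∈ A.carrier, ∀ b ∈ B.carrier, ∀ c ∈ C.carrier, a * b * c ∈ D.carrier) :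
    (A * B * C).carrier ⊆ D.carrier := by
  refine mul_subset fun x hx c hc => D.closure_subset ?_ (tightClosure_mul_right hx hc)
  rintro _ ⟨_, ⟨a, ha, b, hb, rfl⟩, c, hc, rfl⟩
  exact h a ha b hb c hc

instance : Semigroup (TightIdeal R) where
  mul_assoc A B C := by
    ext1
    apply Set.Subset.antisymm
    · refine mul_mul_subset fun a ha b hb c hc => ?_
      rw [mul_assoc]
      exact mem_mul ha (mem_mul hb hc)
    · refine mul_subset fun a ha x hx =>
        (A * B * C).closure_subset ?_ (tightClosure_mul_left ha hx)
      rintro _ ⟨a, ha, _, ⟨b, hb, c, hc, rfl⟩, rfl⟩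
      show a * (b * c) ∈ _
      rw [← mul_assoc]
      exact mem_mul (mem_mul ha hb) hc

theorem mul_inv_mul' (A : TightIdeal R) : A * A⁻¹ * A = A := by
  ext1
  apply Set.Subset.antisymm
  · refine mul_mul_subset fun a ha b hb c hc => A.lower' a ha _ ?_
    have h := (A.compat' _ hb c hc).1
    rw [inv_inv'] at h
    rw [mul_assoc]
    exact mul_idem_le a h
  · intro a ha
    have : a * a⁻¹ * a ∈ (A * A⁻¹ * A).carrier :=
      mem_mul (mem_mul ha (mem_inv.2 (by rwa [inv_inv']))) ha
    rwa [mul_inv_mul] at this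

theorem dom_idem (A : TightIdeal R) {x : R} (hx : x ∈ (A⁻¹ * A).carrier) :
    IsIdempotentElem x := by
  obtain ⟨X, hXA, hX⟩ := hx
  refine idem_of_cover hX fun y hy => ?_
  obtain ⟨a, ha, b, hb, rfl⟩ := hXA hy
  have h := (A.compat' _ ha b hb).1
  rwa [inv_inv'] at h

theorem idem_elem {E : TightIdeal R} (hE : IsIdempotentElem E) {x : R} (hx : x ∈ E.carrier) :
    IsIdempotentElem x := by
  have h1 : E⁻¹ * E * (E * E⁻¹) = E⁻¹ := by
    have h := mul_inv_mul' E⁻¹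
    rw [inv_inv_ideal] at h
    calc E⁻¹ * E * (E * E⁻¹) = E⁻¹ * (E * E) * E⁻¹ := by simp only [mul_assoc]
      _ = E⁻¹ := by rw [hE.eq, h]
  have hx' : x⁻¹ ∈ (E⁻¹ * E * (E * E⁻¹)).carrier := by
    rw [h1, mem_inv, inv_inv']; exact hx
  obtain ⟨X, hXA, hX⟩ := hx'
  have h2 : IsIdempotentElem x⁻¹ := by
    refine idem_of_cover hX fun y hy => ?_
    obtain ⟨a, ha, b, hb, rfl⟩ := hXA hy
    refine idem_mul (dom_idem E ha) (dom_idem E⁻¹ ?_)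
    rw [inv_inv_ideal]
    exact hb
  rw [← inv_inv' x, inv_of_idem h2]
  exact h2

instance : InverseSemigroup (TightIdeal R) :=
  ofCommute (TightIdeal R) mul_inv_mul'
    (fun A => by
      have h := mul_inv_mul' A⁻¹
      rwa [inv_inv_ideal] at h)
    (fun E F hE hF => by
      have key : ∀ E F : TightIdeal R, IsIdempotentElem E → IsIdempotentElem F →
          (E * F).carrier ⊆ (F * E).carrier := fun E F hE hF =>
        mul_subset fun a ha b hb => by
          rw [idem_comm (idem_elem hE ha) (idem_elem hF hb)]
          exact mem_mul hb ha
      ext1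
      exact Set.Subset.antisymm (key E F hE hF) (key F E hF hE))

/-- The natural partial order on closed ideals is inclusion. -/
theorem le_iff {A B : TightIdeal R} : A ≤ B ↔ A.carrier ⊆ B.carrier := by
  rw [le_def]
  constructor
  · intro h
    rw [h]
    exact mul_subset fun b hb e he => B.lower' b hb _ (mul_idem_le b (dom_idem A he))
  · intro h
    ext1
    apply Set.Subset.antisymm
    · intro a ha
      have : a * (a⁻¹ * a) ∈ (B * (A⁻¹ * A)).carrier :=
        mem_mul (h ha) (mem_mul (mem_inv.2 (by rwa [inv_inv'])) ha)
      rwa [← mul_assoc a, mul_inv_mul] at this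
    · rw [← mul_assoc]
      refine mul_mul_subset fun b hb c hc a ha => A.lower' a ha _ (idem_mul_le a ?_)
      have := (B.compat' b hb _ (h hc)).2
      rwa [inv_inv'] at this

theorem compatible_elem {A B : TightIdeal R} (h : Compatible A B) {a b : R}
    (ha : a ∈ A.carrier) (hb : b ∈ B.carrier) : Compatible a b :=
  ⟨idem_elem h.1 (mem_mul (mem_inv.2 (by rwa [inv_inv'])) hb),
    idem_elem h.2 (mem_mul ha (mem_inv.2 (by rwa [inv_inv'])))⟩

/-- The join of a compatible set of closed ideals. -/
def join (X : Set (TightIdeal R)) (hX : CompatibleSet X) : TightIdeal R :=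
  closure (⋃ A ∈ X, A.carrier)
    (fun a ha b hb => by
      simp only [Set.mem_iUnion] at ha ⊢
      obtain ⟨A, hA, ha⟩ := ha
      exact ⟨A, hA, A.lower' a ha b hb⟩)
    (fun a ha b hb => by
      simp only [Set.mem_iUnion] at ha hb
      obtain ⟨A, hA, ha⟩ := ha
      obtain ⟨B, hB, hb⟩ := hb
      exact compatible_elem (hX A hA B hB) ha hb)

theorem isLUB_join (X : Set (TightIdeal R)) (hX : CompatibleSet X) : IsLUB X (join X hX) := by
  constructor
  · intro A hA
    exact le_iff.2 fun a ha => subset_tightClosure _ (by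
      simp only [Set.mem_iUnion]; exact ⟨A, hA, ha⟩)
  · intro B hB
    exact le_iff.2 (B.closure_subset (Set.iUnion₂_subset fun A hA => le_iff.1 (hB hA)))

end TightIdeal

/-- An element `a` is finite if whenever `a` lies below the join of a compatible subset `X`, it
already lies below the join of a finite subset of `X`. -/
def IsFiniteElement {P : Type*} [InverseSemigroup P] (a : P) : Prop :=
  ∀ X : Set P, CompatibleSet X → ∀ j, IsLUB X j → a ≤ j →
    ∃ Y ⊆ X, Y.Finite ∧ ∃ k, IsLUB Y k ∧ a ≤ k

namespace TightIdeal

variable [TightSeparative R]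

/-- The closed ideal generated by one element. -/
def principal (a : R) : TightIdeal R :=
  closure (Set.Iic a) (fun _ hb _ hc => le_trans hc hb) fun _ hs _ ht => Compatible.of_le hs ht

theorem principal_le {a : R} {A : TightIdeal R} (h : a ∈ A.carrier) : principal a ≤ A :=
  le_iff.2 (A.closure_subset fun b hb => A.lower' a h b hb)

theorem isFiniteElement_iff (A : TightIdeal R) :
    IsFiniteElement A ↔
      ∃ F : Set R, F.Finite ∧ A.carrier = tightClosure {x | ∃ f ∈ F, x ≤ f} := by
  constructor
  · intro h
    have hc : CompatibleSet (principal '' A.carrier) := by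
      rintro _ ⟨a, ha, rfl⟩ _ ⟨b, hb, rfl⟩
      exact Compatible.of_le (principal_le ha) (principal_le hb)
    have hlub : IsLUB (principal '' A.carrier) A := by
      refine ⟨?_, fun B hB => le_iff.2 fun a ha => ?_⟩
      · rintro _ ⟨a, ha, rfl⟩
        exact principal_le ha
      · exact le_iff.1 (hB ⟨a, ha, rfl⟩) (subset_tightClosure _ (le_refl a))
    obtain ⟨Y, hY, hYf, k, hk, hAk⟩ := h _ hc A hlub le_rfl
    obtain ⟨F, hFA, hF, rfl⟩ := Set.exists_subset_image_finite_and.1 ⟨Y, hY, hYf, rfl⟩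
    refine ⟨F, hF, Set.Subset.antisymm ?_ (A.closure_subset ?_)⟩
    · have hcF : CompatibleSet (principal '' F) := fun s hs t ht =>
        hc s (hY hs) t (hY ht)
      rw [hk.unique (isLUB_join _ hcF)] at hAk
      refine (le_iff.1 hAk).trans ?_
      rintro x ⟨Z, hZ, hx⟩
      refine mem_tightClosure_of_cover (fun z hz => ?_) hx
      have := hZ hz
      simp only [Set.mem_iUnion] at this
      obtain ⟨_, ⟨f, hf, rfl⟩, hzf⟩ := this
      exact tightClosure_mono (A := Set.Iic f)
        (fun y (hy : y ≤ f) => (⟨f, hf, hy⟩ : ∃ f ∈ F, y ≤ f)) hzf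
    · rintro x ⟨f, hf, hxf⟩
      exact A.lower' f (hFA hf) x hxf
  · rintro ⟨F, hF, hA⟩ X hX j hj hAj
    rw [hj.unique (isLUB_join X hX)] at hAj
    have hFj : ∀ f ∈ F, ∃ Z ⊆ ⋃ B ∈ X, B.carrier, Z ∈ tightCover f := fun f hf =>
      le_iff.1 hAj (by rw [hA]; exact subset_tightClosure _ ⟨f, hf, le_rfl⟩)
    choose! Z hZ hZf using hFj
    have hfin : (⋃ f ∈ F, Z f).Finite := hF.biUnion fun f hf => (hZf f hf).1
    have hmem : ∀ z ∈ ⋃ f ∈ F, Z f, ∃ B ∈ X, z ∈ B.carrier := fun z hz => by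
      simp only [Set.mem_iUnion] at hz
      obtain ⟨f, hf, hz⟩ := hz
      have := hZ f hf hz
      simp only [Set.mem_iUnion] at this
      obtain ⟨B, hB, hzB⟩ := this
      exact ⟨B, hB, hzB⟩
    have : Nonempty (TightIdeal R) := ⟨A⟩
    choose! b hbX hb using hmem
    have hsub : b '' (⋃ f ∈ F, Z f) ⊆ X := Set.image_subset_iff.2 hbX
    have hY : CompatibleSet (b '' (⋃ f ∈ F, Z f)) := fun s hs t ht => hX s (hsub hs) t (hsub ht)
    refine ⟨_, hsub, hfin.image b, join _ hY, isLUB_join _ hY, le_iff.2 ?_⟩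
    rw [hA]
    refine (join _ hY).closure_subset ?_
    rintro x ⟨f, hf, hxf⟩
    refine (join _ hY).lower' f ⟨Z f, fun z hz => ?_, hZf f hf⟩ x hxf
    have hz' : z ∈ ⋃ f ∈ F, Z f := by
      simp only [Set.mem_iUnion]; exact ⟨f, hf, hz⟩
    simp only [Set.mem_iUnion]
    exact ⟨b z, ⟨z, hz', rfl⟩, hb z hz'⟩

theorem isFiniteElement_mul {A B : TightIdeal R} (hA : IsFiniteElement A)
    (hB : IsFiniteElement B) : IsFiniteElement (A * B) := by
  rw [isFiniteElement_iff] at hA hB ⊢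
  obtain ⟨F, hF, hA⟩ := hA
  obtain ⟨G, hG, hB⟩ := hB
  have hFA : F ⊆ A.carrier := fun f hf => by
    rw [hA]; exact subset_tightClosure _ ⟨f, hf, le_rfl⟩
  have hGB : G ⊆ B.carrier := fun g hg => by
    rw [hB]; exact subset_tightClosure _ ⟨g, hg, le_rfl⟩
  refine ⟨F * G, hF.mul hG, Set.Subset.antisymm ?_ ((A * B).closure_subset ?_)⟩
  · rintro x ⟨X, hX, hx⟩
    refine mem_tightClosure_of_cover (fun y hy => ?_) hx
    obtain ⟨a, ha, b, hb, rfl⟩ := hX hy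
    rw [hA] at ha
    rw [hB] at hb
    obtain ⟨U, hU, hUa⟩ := ha
    obtain ⟨V, hV, hVb⟩ := hb
    refine ⟨U * V, ?_, tightCover_mul hUa hVb⟩
    rintro _ ⟨u, hu, v, hv, rfl⟩
    obtain ⟨f, hf, huf⟩ := hU hu
    obtain ⟨g, hg, hvg⟩ := hV hv
    exact ⟨f * g, Set.mul_mem_mul hf hg, mul_le_mul'' huf hvg⟩
  · rintro x ⟨_, ⟨f, hf, g, hg, rfl⟩, hx⟩
    exact (A * B).lower' _ (mem_mul (hFA hf) (hGB hg)) x hx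

theorem isFiniteElement_inv {A : TightIdeal R} (hA : IsFiniteElement A) :
    IsFiniteElement A⁻¹ := by
  rw [isFiniteElement_iff] at hA ⊢
  obtain ⟨F, hF, hA⟩ := hA
  refine ⟨(fun x => x⁻¹) '' F, hF.image _, Set.Subset.antisymm ?_ (closure_subset _ ?_)⟩
  · intro x hx
    rw [mem_inv, hA] at hx
    obtain ⟨X, hX, hx⟩ := hx
    have := tightCover_inv hx
    rw [inv_inv'] at this
    refine ⟨_, ?_, this⟩
    rintro _ ⟨y, hy, rfl⟩
    obtain ⟨f, hf, hyf⟩ := hX hy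
    exact ⟨f⁻¹, ⟨f, hf, rfl⟩, inv_le_inv' hyf⟩
  · rintro x ⟨_, ⟨f, hf, rfl⟩, hx⟩
    rw [mem_inv]
    have h := inv_le_inv' hx
    rw [inv_inv'] at h
    refine A.lower' f ?_ _ h
    rw [hA]
    exact subset_tightClosure _ ⟨f, hf, le_rfl⟩

end TightIdeal

end Ideals

/-! ### The tight completion -/

section Completion

variable (S : Type*) [InverseSemigroup S]

/-- The universal pseudogroup of `S` with respect to the tight coverage: the closed compatible
order ideals of the quotient of `S` by `≡`. -/
abbrev TightPseudogroup : Type _ := TightIdeal (TightQuotient S)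

/-- The tight completion `D_t(S)`: the finite elements of the universal pseudogroup, with its
multiplication. -/
structure TightCompletion where
  val : TightPseudogroup S
  property : IsFiniteElement val

variable {S}

theorem TightCompletion.val_injective :
    Function.Injective (TightCompletion.val (S := S)) := by
  rintro ⟨A, _⟩ ⟨B, _⟩ h
  cases h
  rfl

instance : Mul (TightCompletion S) where
  mul A B := ⟨A.val * B.val, TightIdeal.isFiniteElement_mul A.property B.property⟩

instance : Inv (TightCompletion S) where
  inv A := ⟨A.val⁻¹, TightIdeal.isFiniteElement_inv A.property⟩

instance : Semigroup (TightCompletion S) :=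
  TightCompletion.val_injective.semigroup _ fun _ _ => rfl

instance : InverseSemigroup (TightCompletion S) :=
  ofCommute (TightCompletion S)
    (fun A => TightCompletion.val_injective (mul_inv_mul A.val))
    (fun A => TightCompletion.val_injective (inv_mul_inv A.val))
    (fun _ _ hE hF => TightCompletion.val_injective
      (idem_comm (congrArg TightCompletion.val hE) (congrArg TightCompletion.val hF)))

end Completion

/-! ### Filters and the universal groupoid -/

variable (S : Type*) [InverseSemigroup S]

/-- The proper filters of `S`: non-empty, upward closed, (downward) directed subsets not
containing zero. These are the elements of the universal groupoid `G_u(S)`. -/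
@[ext] structure UniversalGroupoid where
  carrier : Set S
  nonempty' : carrier.Nonempty
  upper' : ∀ a ∈ carrier, ∀ b, a ≤ b → b ∈ carrier
  directed' : ∀ a ∈ carrier, ∀ b ∈ carrier, ∃ c ∈ carrier, c ≤ a ∧ c ≤ b
  proper' : ∀ a ∈ carrier, ¬ IsBot a

variable {S}

namespace UniversalGroupoid

/-- `A` is an idempotent filter if it contains an idempotent. -/
def IsIdempotent (A : UniversalGroupoid S) : Prop := ∃ e ∈ A.carrier, IsIdempotentElem e

/-- `A` is a tight filter: it meets every tight covering of each of its elements. -/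
def IsTight (A : UniversalGroupoid S) : Prop :=
  ∀ x ∈ A.carrier, ∀ X ∈ tightCover x, ∃ y ∈ X, y ∈ A.carrier

/-- `A` is an ultrafilter: it is maximal among the proper filters. -/
def IsUltra (A : UniversalGroupoid S) : Prop :=
  ∀ B : UniversalGroupoid S, A.carrier ⊆ B.carrier → A = B

/-- The inverse `A⁻¹` of a filter. -/
instance : Inv (UniversalGroupoid S) where
  inv A :=
    { carrier := {a | a⁻¹ ∈ A.carrier}
      nonempty' := by
        obtain ⟨a, ha⟩ := A.nonempty'
        exact ⟨a⁻¹, by rwa [Set.mem_ofPred_eq, inv_inv']⟩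
      upper' := fun a ha b hab => A.upper' _ ha _ (inv_le_inv' hab)
      directed' := fun a ha b hb => by
        obtain ⟨c, hc, hca, hcb⟩ := A.directed' _ ha _ hb
        have h1 := inv_le_inv' hca
        have h2 := inv_le_inv' hcb
        rw [inv_inv'] at h1 h2
        exact ⟨c⁻¹, by rwa [Set.mem_ofPred_eq, inv_inv'], h1, h2⟩
      proper' := fun a ha h0 => A.proper' _ ha (by
        have := isBot_mul_left (isBot_mul_right h0 a⁻¹) a⁻¹
        rwa [← mul_assoc, inv_mul_inv] at this) }

/-- `r(A) = (A A⁻¹)↑`. -/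
def ran (A : UniversalGroupoid S) : UniversalGroupoid S where
  carrier := {x | ∃ a ∈ A.carrier, ∃ b ∈ (A⁻¹).carrier, a * b ≤ x}
  nonempty' := by
    obtain ⟨a, ha⟩ := A.nonempty'
    obtain ⟨b, hb⟩ := A⁻¹.nonempty'
    exact ⟨a * b, a, ha, b, hb, le_rfl⟩
  upper' := fun _ ⟨a, ha, b, hb, h⟩ _ hx => ⟨a, ha, b, hb, h.trans hx⟩
  directed' := by
    rintro x ⟨a, ha, b, hb, hx⟩ y ⟨c, hc, d, hd, hy⟩
    obtain ⟨u, hu, hua, huc⟩ := A.directed' a ha c hc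
    obtain ⟨v, hv, hvb, hvd⟩ := A⁻¹.directed' b hb d hd
    exact ⟨u * v, ⟨u, hu, v, hv, le_rfl⟩, (mul_le_mul'' hua hvb).trans hx,
      (mul_le_mul'' huc hvd).trans hy⟩
  proper' := by
    rintro x ⟨a, ha, b, hb, hx⟩ h0
    obtain ⟨c, hc, hca, hcb⟩ := A.directed' a ha b⁻¹ hb
    have h1 : c * c⁻¹ ≤ x := (mul_le_mul'' hca (by
      have := inv_le_inv' hcb
      rwa [inv_inv'] at this)).trans hx
    have h2 : IsBot (c * c⁻¹) := fun y => h1.trans (h0 y)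
    have h3 := isBot_mul_right h2 c
    rw [mul_inv_mul] at h3
    exact A.proper' c hc h3

/-- `d(A) = (A⁻¹ A)↑`. -/
def dom (A : UniversalGroupoid S) : UniversalGroupoid S := A⁻¹.ran

/-- The groupoid product `A · B = (AB)↑`, defined when `d(A) = r(B)`. -/
def comp (A B : UniversalGroupoid S) (h : A.dom = B.ran) : UniversalGroupoid S where
  carrier := {x | ∃ a ∈ A.carrier, ∃ b ∈ B.carrier, a * b ≤ x}
  nonempty' := by
    obtain ⟨a, ha⟩ := A.nonempty'
    obtain ⟨b, hb⟩ := B.nonempty'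
    exact ⟨a * b, a, ha, b, hb, le_rfl⟩
  upper' := fun _ ⟨a, ha, b, hb, h⟩ _ hx => ⟨a, ha, b, hb, h.trans hx⟩
  directed' := by
    rintro x ⟨a, ha, b, hb, hx⟩ y ⟨c, hc, d, hd, hy⟩
    obtain ⟨u, hu, hua, huc⟩ := A.directed' a ha c hc
    obtain ⟨v, hv, hvb, hvd⟩ := B.directed' b hb d hd
    exact ⟨u * v, ⟨u, hu, v, hv, le_rfl⟩, (mul_le_mul'' hua hvb).trans hx,
      (mul_le_mul'' huc hvd).trans hy⟩
  proper' := by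
    rintro x ⟨a, ha, b, hb, hx⟩ h0
    have hda : a⁻¹ * a ∈ A.dom.carrier :=
      ⟨a⁻¹, (by show a⁻¹⁻¹ ∈ A.carrier; rwa [inv_inv']), a, (by
        show a⁻¹⁻¹ ∈ A.carrier; rwa [inv_inv']), le_rfl⟩
    rw [h] at hda
    obtain ⟨c, hc, d, hd, hcd⟩ := hda
    obtain ⟨u, hu, huc, hud⟩ := B.directed' c hc d⁻¹ hd
    obtain ⟨v, hv, hvu, hvb⟩ := B.directed' u hu b hb
    have h1 : u * u⁻¹ ≤ a⁻¹ * a := (mul_le_mul'' huc (by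
      have := inv_le_inv' hud
      rwa [inv_inv'] at this)).trans hcd
    have h2 : v ≤ a⁻¹ * a * v := by
      have h3 : v * v⁻¹ ≤ a⁻¹ * a := (mul_le_mul'' hvu (inv_le_inv' hvu)).trans h1
      have := mul_le_mul_right'' h3 v
      rwa [mul_inv_mul] at this
    have h4 : IsBot (a * v) := fun y => ((mul_le_mul_left'' hvb a).trans hx).trans (h0 y)
    have h5 := isBot_mul_left h4 a⁻¹
    rw [← mul_assoc] at h5
    exact B.proper' v hv fun y => h2.trans (h5 y)

/-- The basic set `U_{x; x₁, …, xₙ}`: the filters containing `x` and none of the `xᵢ`. -/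
def basicSet (x : S) (t : Finset S) : Set (UniversalGroupoid S) :=
  {A | x ∈ A.carrier ∧ ∀ y ∈ t, y ∉ A.carrier}

/-- The patch topology, with basis the sets `U_{x; x₁, …, xₙ}` where `x₁, …, xₙ ≤ x`. -/
instance : TopologicalSpace (UniversalGroupoid S) :=
  TopologicalSpace.generateFrom {U | ∃ (x : S) (t : Finset S), (∀ y ∈ t, y ≤ x) ∧ U = basicSet x t}

variable (S) in
/-- The identities `A · A⁻¹` of the universal groupoid, as a subspace. -/
def identities : Set (UniversalGroupoid S) := {E | ∃ A : UniversalGroupoid S, E = A.comp A⁻¹ rfl}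

variable (S) in
/-- `G_m(S)`: the ultrafilters, as a subspace of the universal groupoid. -/
def ultrafilters : Set (UniversalGroupoid S) := {A | A.IsUltra}

variable (S) in
/-- The identities `A · A⁻¹` of the groupoid of ultrafilters. -/
def ultraIdentities : Set (UniversalGroupoid S) :=
  {E | ∃ A ∈ ultrafilters S, E = A.comp A⁻¹ rfl}

end UniversalGroupoid

end InverseSemigroup

namespace InverseSemigroup

variable {S : Type*} [InverseSemigroup S]

/-! Call two elements orthogonal if they have no nonzero common lower bound. All six conditions say
that order-theoretic differences can be approximated by finitely many elements:
`HasTightComplements`, the hub of the proof.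

Topologically, the ultrafilters are patch-dense in the tight filters, and tightness is a closed
condition (`closure_ultrafilters`). So the ultrafilters are closed exactly when every tight filter
is maximal. Passing from `A` to its range preserves tightness and reflects maximality, so idempotent
filters are enough to test this; and since the identities form an open set, closedness may be tested
inside them.

Compactness: every basic set of the full filter space is compact, so a closed set of ultrafilters
meets it in a compact set. Conversely, an ultrafilter containing `a` but not `f ≤ a` contains an
element below `a` orthogonal to `f` (`isUltra_iff`); compactness leaves finitely many such elements,
and together with `f` they cover `a`. Such a covering forces a tight filter containing `a` and
omitting `f` to contain an element orthogonal to `f`, so it is an ultrafilter.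

Algebraically, the tight completion is always distributive, so only relative complements of
idempotents are at stake. Complements of finitely generated closed ideals are finitely generated
when the quotient by `≡` has tight complements, and complements of principal ideals give these back
(`TightCompletion.isWeaklyBoolean_iff`). Finally the property passes between `S` and its quotient.
-/

/-- Every pair `f ≤ a` splits tightly: `a` is covered by `f` and finitely many elements which have
no nonzero lower bound in common with `f`. -/
def HasTightComplements (S : Type*) [InverseSemigroup S] : Prop :=
  ∀ a f : S, f ≤ a → ∃ X : Set S, (∀ x ∈ X, ∀ u, u ≤ x → u ≤ f → IsBot u) ∧
    insert f X ∈ tightCover a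

theorem eq_ran_mul {c a : S} (h : c ≤ a) : c * c⁻¹ * a = c := (le_iff_left.1 h).symm

theorem mul_mul_inv_of_le {z b a : S} (h : z ≤ b * a⁻¹) : z * a * a⁻¹ = z := by
  have h1 := le_def.1 h
  calc z * a * a⁻¹ = b * a⁻¹ * (z⁻¹ * z) * a * a⁻¹ := by rw [← h1]
    _ = b * a⁻¹ * ((z⁻¹ * z) * (a * a⁻¹)) := by simp only [mul_assoc]
    _ = b * (a⁻¹ * a * a⁻¹) * (z⁻¹ * z) := by
        rw [idem_comm (idem_inv_mul z) (idem_mul_inv a)]; simp only [mul_assoc]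
    _ = z := by rw [inv_mul_inv, ← h1]

/-! ### Filters, ultrafilters and tightness. -/

namespace UniversalGroupoid

variable {A B : UniversalGroupoid S}

theorem mem_of_le {a b : S} (ha : a ∈ A.carrier) (h : a ≤ b) : b ∈ A.carrier := A.upper' a ha b h

/-- The product `x * (y⁻¹ * y)` replaces the meet, which need not exist: it lies above every common
lower bound of `x` and `y`, and below both as soon as these have an upper bound in common. -/
theorem mul_dom_mem {x y : S} (hx : x ∈ A.carrier) (hy : y ∈ A.carrier) :
    x * (y⁻¹ * y) ∈ A.carrier := by
  obtain ⟨c, hc, hcx, hcy⟩ := A.directed' x hx y hy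
  exact mem_of_le hc (le_mul_dom hcx hcy)

/-- The filter generated by a downward directed family of nonzero elements. -/
def generate (D : Set S) (hne : D.Nonempty) (hd : ∀ a ∈ D, ∀ b ∈ D, ∃ c ∈ D, c ≤ a ∧ c ≤ b)
    (h0 : ∀ a ∈ D, ¬ IsBot a) : UniversalGroupoid S where
  carrier := {x | ∃ d ∈ D, d ≤ x}
  nonempty' := hne.imp fun d hd => ⟨d, hd, le_rfl⟩
  upper' := fun _ ⟨d, hd, h⟩ _ hb => ⟨d, hd, h.trans hb⟩
  directed' := by
    rintro x ⟨d, hdD, hx⟩ y ⟨e, heD, hy⟩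
    obtain ⟨c, hc, hcd, hce⟩ := hd d hdD e heD
    exact ⟨c, ⟨c, hc, le_rfl⟩, hcd.trans hx, hce.trans hy⟩
  proper' := fun _ ⟨d, hd, h⟩ hb => h0 d hd fun y => h.trans (hb y)

theorem exists_finite_lower_bound {a : S} (ha : a ∈ A.carrier) {X : Set S} (hX : X.Finite)
    (h : X ⊆ A.carrier) : ∃ c ∈ A.carrier, c ≤ a ∧ ∀ x ∈ X, c ≤ x := by
  induction X, hX using Set.Finite.induction_on with
  | empty => exact ⟨a, ha, le_rfl, by simp⟩
  | @insert x X _ _ ih =>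
    obtain ⟨c, hc, hca, hcX⟩ := ih fun y hy => h (Set.mem_insert_of_mem _ hy)
    obtain ⟨d, hd, hdc, hdx⟩ := A.directed' c hc x (h (Set.mem_insert _ _))
    refine ⟨d, hd, hdc.trans hca, ?_⟩
    rintro y (rfl | hy)
    · exact hdx
    · exact hdc.trans (hcX y hy)

/-- If no `b` is orthogonal to `x`, the restrictions of `x` to the domains of the `b` are nonzero
and generate a larger proper filter. Conversely, orthogonal elements never lie in one proper filter.
-/
theorem isUltra_iff : A.IsUltra ↔ ∀ a ∈ A.carrier, ∀ x ≤ a, x ∉ A.carrier →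
    ∃ b ∈ A.carrier, b ≤ a ∧ ∀ u, u ≤ x → u ≤ b → IsBot u := by
  constructor
  · intro hA a ha x hxa hx
    by_contra! hcon
    have hnb : ∀ b ∈ A.carrier, b ≤ a → ¬ IsBot (x * (b⁻¹ * b)) := fun b hb hba h0 => by
      obtain ⟨u, hux, hub, hu⟩ := hcon b hb hba
      exact hu fun y => (le_mul_dom hux hub).trans (h0 y)
    let F : UniversalGroupoid S := generate
      {z | ∃ b ∈ A.carrier, b ≤ a ∧ z = x * (b⁻¹ * b)} ⟨_, a, ha, le_rfl, rfl⟩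
      (by
        rintro _ ⟨b, hb, hba, rfl⟩ _ ⟨c, hc, hca, rfl⟩
        obtain ⟨d, hd, hdb, hdc⟩ := A.directed' b hb c hc
        exact ⟨_, ⟨d, hd, hdb.trans hba, rfl⟩,
          mul_le_mul_left'' (mul_le_mul'' (inv_le_inv' hdb) hdb) x,
          mul_le_mul_left'' (mul_le_mul'' (inv_le_inv' hdc) hdc) x⟩)
      (by
        rintro _ ⟨b, hb, hba, rfl⟩
        exact hnb b hb hba)
    have hAF : A.carrier ⊆ F.carrier := fun y hy => by
      obtain ⟨b, hb, hby, hba⟩ := A.directed' y hy a ha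
      exact ⟨_, ⟨b, hb, hba, rfl⟩, (mul_dom_le hxa hba).trans hby⟩
    refine hx ?_
    rw [hA F hAF]
    exact ⟨_, ⟨a, ha, le_rfl, rfl⟩, mul_idem_le x (idem_inv_mul a)⟩
  · intro h B hAB
    ext y
    refine ⟨fun hy => hAB hy, fun hy => ?_⟩
    by_contra hyA
    obtain ⟨a, ha⟩ := A.nonempty'
    -- The criterion applies only below `a`, so `y` is replaced by a lower bound of `a` and `y` in
    -- `B`; it is still outside `A`.
    obtain ⟨x, hx, hxa, hxy⟩ := B.directed' a (hAB ha) y hy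
    obtain ⟨b, hb, -, hbot⟩ := h a ha x hxa fun hxA => hyA (mem_of_le hxA hxy)
    obtain ⟨u, hu, hux, hub⟩ := B.directed' x hx b (hAB hb)
    exact B.proper' u hu (hbot u hux hub)

/-- If a covering misses `A`, each of its members is orthogonal to some element of `A`. A common
lower bound of these finitely many elements in `A` is nonzero yet orthogonal to the whole covering.
-/
theorem IsUltra.isTight (hA : A.IsUltra) : A.IsTight := by
  intro a ha X hX
  by_contra! hcon
  choose! b hbA hba hb using fun x (hx : x ∈ X) =>
    isUltra_iff.1 hA a ha x (hX.2.1 x hx) (hcon x hx)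
  obtain ⟨c, hc, hca, hcb⟩ := exists_finite_lower_bound ha (hX.1.image b)
    (Set.image_subset_iff.2 hbA)
  obtain ⟨x, hx, y, hy0, hyc, hyx⟩ := hX.2.2 c hca (A.proper' c hc)
  exact hy0 (hb x hx y hyx (hyc.trans (hcb _ ⟨x, hx, rfl⟩)))

theorem exists_isUltra_mem {z : S} (hz : ¬ IsBot z) :
    ∃ A : UniversalGroupoid S, A.IsUltra ∧ z ∈ A.carrier := by
  let F : Set (Set S) := {C | z ∈ C ∧ ∃ A : UniversalGroupoid S, A.carrier = C}
  have hzF : (generate {z} ⟨z, rfl⟩ (by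
      rintro _ rfl _ rfl
      exact ⟨_, rfl, le_rfl, le_rfl⟩) (by rintro _ rfl; exact hz)).carrier ∈ F :=
    ⟨⟨z, rfl, le_rfl⟩, _, rfl⟩
  obtain ⟨M, -, hM⟩ := zorn_subset_nonempty F (fun c hcF hc hne => by
    obtain ⟨C₀, hC₀⟩ := hne
    refine ⟨⋃₀ c, ⟨⟨C₀, hC₀, (hcF hC₀).1⟩, ⟨⋃₀ c, ?_, ?_, ?_, ?_⟩, rfl⟩,
      fun s hs => Set.subset_sUnion_of_mem hs⟩
    · exact ⟨z, C₀, hC₀, (hcF hC₀).1⟩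
    · rintro a ⟨C, hC, ha⟩ b hab
      obtain ⟨-, A, rfl⟩ := hcF hC
      exact ⟨_, hC, A.upper' a ha b hab⟩
    · rintro a ⟨C, hC, ha⟩ b ⟨C', hC', hb⟩
      obtain ⟨C'', hC'', h, h'⟩ : ∃ C'' ∈ c, C ⊆ C'' ∧ C' ⊆ C'' := by
        rcases hc.total hC hC' with h | h
        · exact ⟨C', hC', h, le_rfl⟩
        · exact ⟨C, hC, le_rfl, h⟩
      obtain ⟨-, A, rfl⟩ := hcF hC''
      obtain ⟨d, hd, hda, hdb⟩ := A.directed' a (h ha) b (h' hb)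
      exact ⟨d, ⟨_, hC'', hd⟩, hda, hdb⟩
    · rintro a ⟨C, hC, ha⟩
      obtain ⟨-, A, rfl⟩ := hcF hC
      exact A.proper' a ha) _ hzF
  obtain ⟨hzM, A, rfl⟩ := hM.prop
  refine ⟨A, fun B hAB => UniversalGroupoid.ext ?_, hzM⟩
  exact hAB.antisymm (hM.le_of_ge ⟨hAB hzM, B, rfl⟩ hAB)

/-! ### Ranges of filters -/

/-- With `mem_ran_of_mul_mem` this gives, for any fixed `a ∈ A`, that `x ∈ A.ran` iff `x * a ∈ A`;
translation by `a` then transfers tightness and maximality from `A` to its range. -/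
theorem ran_mul_mem {x a : S} (hx : x ∈ A.ran.carrier) (ha : a ∈ A.carrier) :
    x * a ∈ A.carrier := by
  obtain ⟨b, hb, c, hc, hbc⟩ := hx
  obtain ⟨d, hd, hda, hdX⟩ := exists_finite_lower_bound ha (X := {b, c⁻¹}) (Set.toFinite _) (by
    rintro _ (rfl | rfl)
    exacts [hb, hc])
  have h1 : d * d⁻¹ ≤ x := (mul_le_mul'' (hdX b (by simp)) (by
    have := inv_le_inv' (hdX c⁻¹ (by simp))
    rwa [inv_inv'] at this)).trans hbc
  have h2 := mul_le_mul'' h1 hda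
  rw [mul_inv_mul] at h2
  exact mem_of_le hd h2

theorem mul_inv_mem_ran {b a : S} (hb : b ∈ A.carrier) (ha : a ∈ A.carrier) :
    b * a⁻¹ ∈ A.ran.carrier :=
  ⟨b, hb, a⁻¹, by show a⁻¹⁻¹ ∈ A.carrier; rwa [inv_inv'], le_rfl⟩

theorem mem_ran_of_mul_mem {x a : S} (ha : a ∈ A.carrier) (h : x * a ∈ A.carrier) :
    x ∈ A.ran.carrier := by
  refine mem_of_le (mul_inv_mem_ran h ha) ?_
  rw [mul_assoc]
  exact mul_idem_le x (idem_mul_inv a)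

theorem IsTight.ran (hA : A.IsTight) : A.ran.IsTight := by
  intro x hx X hX
  obtain ⟨a, ha⟩ := A.nonempty'
  obtain ⟨_, ⟨y, hy, rfl⟩, hya⟩ := hA (x * a) (ran_mul_mem hx ha) _ (tightCover_mul_right hX a)
  exact ⟨y, hy, mem_ran_of_mul_mem ha hya⟩

theorem ran_mono (h : A.carrier ⊆ B.carrier) : A.ran.carrier ⊆ B.ran.carrier := by
  rintro x ⟨a, ha, b, hb, hab⟩
  exact ⟨a, h ha, b, h hb, hab⟩

/-- A filter is determined by its range and one element `a`: any `c ≤ a` equals `c * c⁻¹ * a`. Hence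
a larger filter with the same range is no larger. -/
theorem isUltra_of_ran (hA : A.ran.IsUltra) : A.IsUltra := by
  intro B hAB
  ext b
  refine ⟨fun hb => hAB hb, fun hb => ?_⟩
  obtain ⟨a, ha⟩ := A.nonempty'
  obtain ⟨c, hc, hca, hcb⟩ := B.directed' a (hAB ha) b hb
  have h1 : c * c⁻¹ ∈ A.ran.carrier := by
    rw [hA B.ran (ran_mono hAB)]
    exact mul_inv_mem_ran hc hc
  have h2 := ran_mul_mem h1 ha
  rw [eq_ran_mul hca] at h2
  exact mem_of_le h2 hcb

theorem IsUltra.ran (hA : A.IsUltra) : A.ran.IsUltra := by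
  rw [isUltra_iff]
  intro e he x hxe hx
  obtain ⟨a, ha⟩ := A.nonempty'
  obtain ⟨a', ha', haa, haea⟩ := A.directed' a ha _ (ran_mul_mem he ha)
  obtain ⟨b, hb, hbe, hbot⟩ := isUltra_iff.1 hA _ (ran_mul_mem he ha) _ (mul_le_mul_right'' hxe a)
    fun h => hx (mem_ran_of_mul_mem ha h)
  refine ⟨b * a⁻¹, mul_inv_mem_ran hb ha, ?_, fun u hux hub => ?_⟩
  · refine (mul_le_mul_right'' hbe a⁻¹).trans ?_
    rw [mul_assoc]
    exact mul_idem_le e (idem_mul_inv a)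
  · have h1 : IsBot (u * a) := hbot _ (mul_le_mul_right'' hux a) (by
      refine (mul_le_mul_right'' hub a).trans ?_
      rw [mul_assoc]
      exact mul_idem_le b (idem_inv_mul a))
    -- Since `u` lies below `b * a⁻¹`, translating by `a` and back loses nothing.
    have h2 := isBot_mul_right h1 a⁻¹
    rwa [mul_mul_inv_of_le hub] at h2

theorem ran_isIdempotent (A : UniversalGroupoid S) : A.ran.IsIdempotent := by
  obtain ⟨a, ha⟩ := A.nonempty'
  exact ⟨a * a⁻¹, mul_inv_mem_ran ha ha, idem_mul_inv a⟩

theorem IsIdempotent.ran_eq (hA : A.IsIdempotent) : A.ran = A := by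
  obtain ⟨e, he, hee⟩ := hA
  ext x
  constructor
  · intro hx
    have h := ran_mul_mem hx he
    exact mem_of_le h (mul_idem_le x hee)
  · intro hx
    obtain ⟨c, hc, hcx, hce⟩ := A.directed' x hx e he
    have h := mul_inv_mem_ran hc hc
    rw [inv_of_idem (idem_of_le hce hee), (idem_of_le hce hee).eq] at h
    exact mem_of_le h hcx

theorem mem_identities : A ∈ identities S ↔ A.IsIdempotent := by
  constructor
  · rintro ⟨B, rfl⟩
    exact ran_isIdempotent B
  · intro h
    exact ⟨A, h.ran_eq.symm⟩

theorem mem_ultraIdentities : A ∈ ultraIdentities S ↔ A.IsIdempotent ∧ A.IsUltra := by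
  constructor
  · rintro ⟨B, hB, rfl⟩
    exact ⟨ran_isIdempotent B, IsUltra.ran hB⟩
  · rintro ⟨h, h'⟩
    exact ⟨A, h', h.ran_eq.symm⟩

/-! ### The patch topology -/

theorem isOpen_basicSet {x : S} {t : Finset S} (h : ∀ y ∈ t, y ≤ x) : IsOpen (basicSet x t) :=
  TopologicalSpace.isOpen_generateFrom_of_mem ⟨x, t, h, rfl⟩

theorem isTopologicalBasis_basicSet : TopologicalSpace.IsTopologicalBasis
    {U : Set (UniversalGroupoid S) | ∃ (x : S) (t : Finset S), (∀ y ∈ t, y ≤ x) ∧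
      U = basicSet x t} where
  exists_subset_inter := by
    classical
    rintro _ ⟨x, t, ht, rfl⟩ _ ⟨x', t', ht', rfl⟩ A ⟨⟨hx, hxt⟩, hx', hxt'⟩
    obtain ⟨c, hc, hcx, hcx'⟩ := A.directed' x hx x' hx'
    -- The excluded elements must lie below `c`, so each `y` is cut down to `y * (c⁻¹ * c)`; a
    -- filter containing `c` contains one iff it contains the other.
    refine ⟨_, ⟨c, (t ∪ t').image fun y => y * (c⁻¹ * c), fun y hy => ?_, rfl⟩, ⟨hc, fun y hy => ?_⟩,
      ?_⟩
    · obtain ⟨y, hyt, rfl⟩ := Finset.mem_image.1 hy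
      rcases Finset.mem_union.1 hyt with hy | hy
      · exact mul_dom_le (ht y hy) hcx
      · exact mul_dom_le (ht' y hy) hcx'
    · obtain ⟨y, hyt, rfl⟩ := Finset.mem_image.1 hy
      intro h
      have h' := mem_of_le h (mul_idem_le y (idem_inv_mul c))
      rcases Finset.mem_union.1 hyt with hy | hy
      exacts [hxt y hy h', hxt' y hy h']
    · rintro B ⟨hcB, hB⟩
      refine ⟨⟨mem_of_le hcB hcx, fun y hy hyB => ?_⟩, mem_of_le hcB hcx', fun y hy hyB => ?_⟩
      · exact hB _ (Finset.mem_image_of_mem _ (Finset.mem_union_left _ hy))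
          (mul_dom_mem hyB hcB)
      · exact hB _ (Finset.mem_image_of_mem _ (Finset.mem_union_right _ hy))
          (mul_dom_mem hyB hcB)
  sUnion_eq := by
    refine Set.eq_univ_of_forall fun A => ?_
    obtain ⟨a, ha⟩ := A.nonempty'
    exact ⟨_, ⟨a, ∅, by simp, rfl⟩, ha, by simp⟩
  eq_generateFrom := rfl

theorem isClosed_setOf_isTight : IsClosed {A : UniversalGroupoid S | A.IsTight} := by
  rw [← isOpen_compl_iff, isOpen_iff_forall_mem_open]
  intro A hA
  have hA' : ¬ A.IsTight := hA
  unfold IsTight at hA'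
  push Not at hA'
  obtain ⟨x, hx, X, hX, h⟩ := hA'
  refine ⟨basicSet x hX.1.toFinset, ?_, isOpen_basicSet fun y hy => hX.2.1 y (by simpa using hy),
    hx, fun y hy => h y (by simpa using hy)⟩
  rintro B ⟨hxB, hB⟩ hBt
  obtain ⟨y, hy, hyB⟩ := hBt x hxB X hX
  exact hB y (by simpa using hy) hyB

/-- If a tight filter lies in the basic set of `x` and `t`, then `t` does not cover `x`. Some
nonzero `z ≤ x` is therefore orthogonal to all of `t`, and any ultrafilter through `z` lies in the
same basic set. -/
theorem closure_ultrafilters : closure (ultrafilters S) = {A | A.IsTight} := by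
  apply Set.Subset.antisymm
  · exact closure_minimal (fun A hA => IsUltra.isTight hA) isClosed_setOf_isTight
  · intro A hA
    rw [isTopologicalBasis_basicSet.mem_closure_iff]
    rintro _ ⟨x, t, ht, rfl⟩ ⟨hx, hxt⟩
    have hna : ¬ Arrow x (t : Set S) := fun h => by
      obtain ⟨y, hy, hyA⟩ := hA x hx t ⟨t.finite_toSet, ht, h⟩
      exact hxt y hy hyA
    unfold Arrow at hna
    push Not at hna
    obtain ⟨z, hzx, hz0, hz⟩ := hna
    obtain ⟨B, hB, hzB⟩ := exists_isUltra_mem hz0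
    refine ⟨B, ⟨mem_of_le hzB hzx, fun y hy hyB => ?_⟩, hB⟩
    obtain ⟨u, hu, huz, huy⟩ := B.directed' z hzB y hyB
    exact hz y hy u (B.proper' u hu) huz huy

theorem isOpen_identities : IsOpen (identities S) := by
  rw [isOpen_iff_forall_mem_open]
  intro A hA
  obtain ⟨e, he, hee⟩ := mem_identities.1 hA
  exact ⟨basicSet e ∅, fun B hB => mem_identities.2 ⟨e, hB.1, hee⟩, isOpen_basicSet (by simp),
    he, by simp⟩

theorem isCompact_basicSet (x : S) (t : Finset S) : IsCompact (basicSet x t) := by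
  rw [isCompact_iff_ultrafilter_le_nhds]
  intro F hF
  have hF : basicSet x t ∈ F := Filter.le_principal_iff.1 hF
  have hmono : ∀ {y z : S}, y ≤ z → {B : UniversalGroupoid S | y ∈ B.carrier} ∈ F →
      {B : UniversalGroupoid S | z ∈ B.carrier} ∈ F := fun hyz hy =>
    Filter.mem_of_superset hy fun B hB => mem_of_le hB hyz
  -- The limit of `F` consists of the elements that lie in `F`-almost every filter. Generators are
  -- taken below `x`, because the upper bound makes `a * (b⁻¹ * b)` a lower bound of both factors.
  let A : UniversalGroupoid S := generate
    {y | y ≤ x ∧ {B : UniversalGroupoid S | y ∈ B.carrier} ∈ F}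
    ⟨x, le_rfl, Filter.mem_of_superset hF fun B hB => hB.1⟩
    (by
      rintro a ⟨ha, haF⟩ b ⟨hb, hbF⟩
      refine ⟨a * (b⁻¹ * b), ⟨(mul_idem_le a (idem_inv_mul b)).trans ha, ?_⟩,
        mul_idem_le a (idem_inv_mul b), mul_dom_le ha hb⟩
      filter_upwards [haF, hbF] with B h h'
      exact mul_dom_mem h h')
    (by
      rintro a ⟨-, haF⟩ h0
      obtain ⟨B, hB⟩ := F.nonempty_of_mem haF
      exact B.proper' a hB h0)
  refine ⟨A, ⟨⟨x, ⟨le_rfl, Filter.mem_of_superset hF fun B hB => hB.1⟩, le_rfl⟩, ?_⟩, ?_⟩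
  · rintro y hy ⟨z, ⟨-, hzF⟩, hzy⟩
    obtain ⟨B, hB, hB'⟩ := F.nonempty_of_mem (Filter.inter_mem hF (hmono hzy hzF))
    exact hB.2 y hy hB'
  · rw [TopologicalSpace.nhds_generateFrom]
    refine le_iInf₂ fun U hU => ?_
    obtain ⟨hAU, y, s, hs, rfl⟩ := hU
    rw [Filter.le_principal_iff]
    obtain ⟨⟨z, ⟨hzx, hzF⟩, hzy⟩, hsA⟩ := hAU
    have h1 : ∀ w ∈ s, ∀ᶠ B in (F : Filter (UniversalGroupoid S)), w ∉ B.carrier := by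
      intro w hw
      -- The element `w` need not lie below `x`, but its restriction to the domain of `z` does, and
      -- it is not a generator because `w ∉ A`.
      have h2 : {B : UniversalGroupoid S | w * (z⁻¹ * z) ∈ B.carrier} ∉ F := fun h =>
        hsA w hw ⟨_, ⟨(mul_dom_le (hs w hw) hzy).trans hzx, h⟩, mul_idem_le w (idem_inv_mul z)⟩
      filter_upwards [Ultrafilter.compl_mem_iff_notMem.2 h2, hzF] with B hB hzB hwB
      exact hB (mul_dom_mem hwB hzB)
    filter_upwards [hzF, (Filter.eventually_all_finset s).2 h1] with B hzB hB
    exact ⟨mem_of_le hzB hzy, hB⟩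

/-! ### The compactness condition -/

theorem IsTight.isUltra_of_hasTightComplements (hS : HasTightComplements S) (hA : A.IsTight) :
    A.IsUltra := by
  rw [isUltra_iff]
  intro a ha f hfa hf
  obtain ⟨X, hX, hc⟩ := hS a f hfa
  obtain ⟨y, rfl | hy, hyA⟩ := hA a ha _ hc
  · exact absurd hyA hf
  · exact ⟨y, hyA, hc.2.1 y (Or.inr hy), fun u huf huy => hX y hy u huy huf⟩

theorem hasTightComplements_of_isCompact
    (h : ∀ a f : S, f ≤ a → IsCompact (basicSet a {f} ∩ ultrafilters S)) :
    HasTightComplements S := by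
  classical
  intro a f hfa
  let Z := {x : S // x ≤ a ∧ ∀ u, u ≤ x → u ≤ f → IsBot u}
  -- By `isUltra_iff`, each ultrafilter containing `a` and not `f` contains an element below `a`
  -- orthogonal to `f`; these elements index an open cover.
  obtain ⟨T, hT⟩ := (h a f hfa).elim_finite_subcover
    (fun x : Z => basicSet x.1 ∅)
    (fun x => isOpen_basicSet (by simp)) (by
      rintro B ⟨⟨haB, hfB⟩, hB⟩
      obtain ⟨b, hb, hba, hbot⟩ := isUltra_iff.1 hB a haB f hfa (hfB f (by simp))
      exact Set.mem_iUnion.2 ⟨⟨b, hba, fun u hub huf => hbot u huf hub⟩, hb, by simp⟩)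
  refine ⟨Subtype.val '' (T : Set Z), ?_, (T.finite_toSet.image Subtype.val).insert f, ?_, ?_⟩
  · rintro _ ⟨x, -, rfl⟩
    exact x.2.2
  · rintro _ (rfl | ⟨x, -, rfl⟩)
    exacts [hfa, x.2.1]
  · intro z hza hz0
    -- An ultrafilter through `z` contains either `f` or a member of the finite subcover, and that
    -- element meets `z` inside the ultrafilter.
    obtain ⟨B, hB, hzB⟩ := exists_isUltra_mem hz0
    obtain ⟨y, hy, hyB⟩ : ∃ y ∈ insert f (Subtype.val '' (T : Set Z)), y ∈ B.carrier := by
      by_cases hfB : f ∈ B.carrier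
      · exact ⟨f, Set.mem_insert _ _, hfB⟩
      · obtain ⟨x, hxT, hx⟩ := Set.mem_iUnion₂.1
          (hT ⟨⟨mem_of_le hzB hza, by simpa using hfB⟩, hB⟩)
        exact ⟨x, Or.inr ⟨x, hxT, rfl⟩, hx.1⟩
    obtain ⟨u, hu, huz, huy⟩ := B.directed' z hzB y hyB
    exact ⟨y, hy, u, B.proper' u hu, huz, huy⟩

end UniversalGroupoid

/-! ### Coverings by zeros, and splitting along finitely many idempotents. -/

section Coverage

variable {R : Type*} [InverseSemigroup R]

theorem empty_mem_tightCover {x : R} (h : IsBot x) : ∅ ∈ tightCover x :=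
  ⟨Set.finite_empty, by simp, fun _ hy h0 => absurd (h.mono hy) h0⟩

theorem isBot_of_cover {x : R} {X : Set R} (hX : X ∈ tightCover x) (h : ∀ y ∈ X, IsBot y) :
    IsBot x := by
  by_contra h0
  obtain ⟨b, hb, u, hu0, -, hub⟩ := hX.2.2 x le_rfl h0
  exact hu0 ((h b hb).mono hub)

theorem mem_tightClosure_of_isBot {x : R} (h : IsBot x) (A : Set R) : x ∈ tightClosure A :=
  ⟨∅, Set.empty_subset _, empty_mem_tightCover h⟩

theorem tightClosure_subset_iff {A B : Set R} :
    tightClosure A ⊆ tightClosure B ↔ A ⊆ tightClosure B := by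
  refine ⟨(subset_tightClosure A).trans, ?_⟩
  rintro h x ⟨X, hX, hx⟩
  exact mem_tightClosure_of_cover (hX.trans h) hx

theorem mul_eq_of_idem_le {e f : R} (h : e ≤ f) (he : IsIdempotentElem e) : e * f = e := by
  have := le_iff_left.1 h
  rw [inv_of_idem he, he.eq] at this
  exact this.symm

theorem compatible_of_idem {e f : R} (he : IsIdempotentElem e) (hf : IsIdempotentElem f) :
    Compatible e f :=
  ⟨by rw [inv_of_idem he]; exact idem_mul he hf, by rw [inv_of_idem hf]; exact idem_mul he hf⟩

/-- It suffices to split idempotents. -/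
theorem hasTightComplements_of_idem
    (h : ∀ e g : R, IsIdempotentElem e → IsIdempotentElem g → g ≤ e → ∃ X : Set R,
      (∀ x ∈ X, ∀ u, u ≤ x → u ≤ g → IsBot u) ∧ insert g X ∈ tightCover e) :
    HasTightComplements R := by
  intro a f hfa
  have hg : f⁻¹ * f ≤ a⁻¹ * a := mul_le_mul'' (inv_le_inv' hfa) hfa
  obtain ⟨X, hX, hc⟩ := h (a⁻¹ * a) (f⁻¹ * f) (idem_inv_mul a) (idem_inv_mul f) hg
  refine ⟨(fun x => a * x) '' X, ?_, ?_⟩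
  · rintro _ ⟨x, hx, rfl⟩ u hux huf
    have h1 : IsBot (a⁻¹ * u) := by
      refine hX x hx _ ?_ ?_
      · refine (mul_le_mul_left'' hux a⁻¹).trans ?_
        rw [← mul_assoc]
        exact idem_mul_le x (idem_inv_mul a)
      · refine (mul_le_mul_left'' huf a⁻¹).trans ?_
        conv_lhs => rw [le_def.1 hfa, ← mul_assoc]
        exact idem_mul_le _ (idem_inv_mul a)
    refine (isBot_mul_left h1 a).mono ?_
    have h2 := le_def.1 (huf.trans hfa)
    refine le_of_eq ?_
    calc u = a * a⁻¹ * a * (u⁻¹ * u) := by rw [mul_inv_mul]; exact h2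
      _ = a * (a⁻¹ * (a * (u⁻¹ * u))) := by simp only [mul_assoc]
      _ = a * (a⁻¹ * u) := by rw [← h2]
  -- Translation by `a` turns `a⁻¹ * a` into `a` and `f⁻¹ * f` into `f`.
  · have := tightCover_mul_left hc a
    rwa [Set.image_insert_eq, ← mul_assoc a a⁻¹, mul_inv_mul, ← le_def.1 hfa] at this

/-- An idempotent is covered by elements below one of finitely many given idempotents and elements
orthogonal to all of them. -/
theorem HasTightComplements.mem_tightClosure (hR : HasTightComplements R) {F : Set R}
    (hF : F.Finite) (hFi : ∀ f ∈ F, IsIdempotentElem f) {e : R} (he : IsIdempotentElem e) :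
    e ∈ tightClosure {x | x ≤ e ∧ ((∃ f ∈ F, x ≤ f) ∨ ∀ f ∈ F, IsBot (x * f))} := by
  induction F, hF using Set.Finite.induction_on generalizing e with
  | empty => exact subset_tightClosure _ ⟨le_rfl, Or.inr (by simp)⟩
  | @insert f F _ _ ih =>
    have hf := hFi f (Set.mem_insert _ _)
    -- Split off the part of `e` under `f`; the pieces orthogonal to it are split along the
    -- remaining idempotents by induction.
    obtain ⟨X, hX, hc⟩ := hR e (e * f) (mul_idem_le e hf)
    refine mem_tightClosure_of_cover ?_ hc
    rintro x (rfl | hx)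
    · exact subset_tightClosure _ ⟨mul_idem_le e hf,
        Or.inl ⟨f, Set.mem_insert _ _, idem_mul_le f he⟩⟩
    · have hxe := hc.2.1 x (Set.mem_insert_of_mem _ hx)
      refine tightClosure_mono ?_
        (ih (fun g hg => hFi g (Set.mem_insert_of_mem _ hg)) (idem_of_le hxe he))
      rintro y ⟨hyx, ⟨g, hg, hyg⟩ | hy⟩
      · exact ⟨hyx.trans hxe, Or.inl ⟨g, Set.mem_insert_of_mem _ hg, hyg⟩⟩
      · refine ⟨hyx.trans hxe, Or.inr ?_⟩
        rintro g (rfl | hg)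
        · exact hX x hx _ ((mul_idem_le y hf).trans hyx) (mul_le_mul_right'' (hyx.trans hxe) _)
        · exact hy g hg

end Coverage

/-! ### Idempotent and finitely generated closed ideals. -/

namespace TightIdeal

variable {R : Type*} [InverseSemigroup R]

theorem tightClosure_carrier (A : TightIdeal R) : tightClosure A.carrier = A.carrier :=
  (A.closure_subset le_rfl).antisymm (subset_tightClosure _)

variable [TightSeparative R]

theorem isIdempotentElem_iff {E : TightIdeal R} :
    IsIdempotentElem E ↔ ∀ x ∈ E.carrier, IsIdempotentElem x := by
  refine ⟨fun hE x hx => idem_elem hE hx, fun h => ?_⟩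
  ext1
  apply Set.Subset.antisymm
  · exact mul_subset fun a ha b hb => E.lower' a ha _ (mul_idem_le a (h b hb))
  · intro x hx
    have := mem_mul hx hx
    rwa [(h x hx).eq] at this

theorem carrier_mul_of_idem {E F : TightIdeal R} (hE : IsIdempotentElem E)
    (hF : IsIdempotentElem F) : (E * F).carrier = E.carrier ∩ F.carrier := by
  rw [isIdempotentElem_iff] at hE hF
  apply Set.Subset.antisymm
  · exact Set.subset_inter
      (mul_subset fun a ha b hb => E.lower' a ha _ (mul_idem_le a (hF b hb)))
      (mul_subset fun a ha b hb => F.lower' b hb _ (idem_mul_le b (hE a ha)))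
  · rintro x ⟨hx, hx'⟩
    have := mem_mul hx hx'
    rwa [(hE x hx).eq] at this

theorem isFiniteElement_principal (a : R) : IsFiniteElement (principal a) := by
  rw [isFiniteElement_iff]
  exact ⟨{a}, Set.finite_singleton a, congrArg tightClosure (by ext; simp)⟩

theorem mem_principal_self (a : R) : a ∈ (principal a).carrier :=
  subset_tightClosure _ (le_refl a)

theorem isIdempotentElem_principal {e : R} (he : IsIdempotentElem e) :
    IsIdempotentElem (principal e) :=
  isIdempotentElem_iff.2 fun _ ⟨_, hX, hx⟩ =>
    idem_of_cover hx fun _ hy => idem_of_le (hX hy) he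

theorem isFiniteElement_join {X : Set (TightIdeal R)} (hX : CompatibleSet X) (hf : X.Finite)
    (h : ∀ A ∈ X, IsFiniteElement A) : IsFiniteElement (join X hX) := by
  have h' : ∀ A ∈ X, ∃ F : Set R, F.Finite ∧
      A.carrier = tightClosure {x | ∃ f ∈ F, x ≤ f} := fun A hA =>
    (isFiniteElement_iff A).1 (h A hA)
  choose! F hF hA using h'
  rw [isFiniteElement_iff]
  refine ⟨⋃ A ∈ X, F A, hf.biUnion hF, Set.Subset.antisymm ?_ ?_⟩
  · refine tightClosure_subset_iff.2 (Set.iUnion₂_subset fun A hAX => ?_)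
    rw [hA A hAX]
    refine tightClosure_mono ?_
    rintro x ⟨f, hf, hx⟩
    exact ⟨f, Set.mem_biUnion hAX hf, hx⟩
  · refine tightClosure_mono ?_
    rintro x ⟨f, hf, hx⟩
    obtain ⟨A, hAX, hf⟩ := Set.mem_iUnion₂.1 hf
    refine Set.mem_biUnion hAX ?_
    rw [hA A hAX]
    exact subset_tightClosure _ ⟨f, hf, hx⟩

/-- The part of a closed ideal orthogonal to another one. -/
def sdiff (E F : TightIdeal R) : TightIdeal R where
  carrier := {x | x ∈ E.carrier ∧ ∀ y ∈ F.carrier, IsBot (x * y)}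
  lower' := fun a ⟨ha, h⟩ b hb =>
    ⟨E.lower' a ha b hb, fun y hy => (h y hy).mono (mul_le_mul_right'' hb y)⟩
  compat' := fun a ha b hb => E.compat' a ha.1 b hb.1
  closed' := fun a X hX ha => by
    refine ⟨E.closed' a X (fun x hx => (hX hx).1) ha, fun y hy => ?_⟩
    refine isBot_of_cover (tightCover_mul_right ha y) ?_
    rintro _ ⟨x, hx, rfl⟩
    exact (hX hx).2 y hy

/-- Finiteness of `F` allows an element of `E` to be split along finitely many generators. Each
piece is below a generator, hence in `F`, or annihilates all generators, hence all of `F`. -/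
theorem subset_tightClosure_sdiff (hR : HasTightComplements R) {E F : TightIdeal R}
    (hE : IsIdempotentElem E) (hF : IsIdempotentElem F) (hFf : IsFiniteElement F) :
    E.carrier ⊆ tightClosure (E.carrier ∩ F.carrier ∪ (sdiff E F).carrier) := by
  obtain ⟨G, hG, hFG⟩ := (isFiniteElement_iff F).1 hFf
  have hGF : G ⊆ F.carrier := fun g hg => by
    rw [hFG]; exact subset_tightClosure _ ⟨g, hg, le_rfl⟩
  intro e he
  refine tightClosure_mono ?_ (hR.mem_tightClosure hG
    (fun g hg => idem_elem hF (hGF hg)) (idem_elem hE he))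
  rintro x ⟨hxe, ⟨g, hg, hxg⟩ | hx⟩
  · exact Or.inl ⟨E.lower' e he x hxe, F.lower' g (hGF hg) x hxg⟩
  · refine Or.inr ⟨E.lower' e he x hxe, fun y hy => ?_⟩
    rw [hFG] at hy
    obtain ⟨Y, hY, hYy⟩ := hy
    refine isBot_of_cover (tightCover_mul_left hYy x) ?_
    rintro _ ⟨z, hz, rfl⟩
    obtain ⟨g, hg, hzg⟩ := hY hz
    exact (hx g hg).mono (mul_le_mul_left'' hzg x)

/-- Finitely many elements of `K` and `L` cover the generators of `E`, and those in `L` generate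
`L`: an idempotent of `L` below a generator `f` is covered by its products with a covering of `f`,
and the products with members of `K` vanish. -/
theorem isFiniteElement_of_cover {E L : TightIdeal R} {K : Set R} (hE : IsIdempotentElem E)
    (hEf : IsFiniteElement E) (hcov : E.carrier ⊆ tightClosure (K ∪ L.carrier))
    (hLE : L.carrier ⊆ E.carrier) (hdisj : ∀ l ∈ L.carrier, ∀ k ∈ K, IsBot (l * k)) :
    IsFiniteElement L := by
  obtain ⟨F, hF, hEF⟩ := (isFiniteElement_iff E).1 hEf
  have hFE : F ⊆ E.carrier := fun f hf => by
    rw [hEF]; exact subset_tightClosure _ ⟨f, hf, le_rfl⟩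
  choose! Z hZ hZf using fun f (hf : f ∈ F) => hcov (hFE hf)
  rw [isFiniteElement_iff]
  refine ⟨(⋃ f ∈ F, Z f) ∩ L.carrier, (hF.biUnion fun f hf => (hZf f hf).1).inter_of_left _,
    Set.Subset.antisymm ?_ (L.closure_subset ?_)⟩
  · intro x hx
    have hxE := hLE hx
    rw [hEF] at hxE
    obtain ⟨Y, hY, hYx⟩ := hxE
    refine mem_tightClosure_of_cover (fun y hy => ?_) hYx
    obtain ⟨f, hf, hyf⟩ := hY hy
    have hyL : y ∈ L.carrier := L.lower' x hx y (hYx.2.1 y hy)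
    have hyi : IsIdempotentElem y := idem_elem hE (hLE hyL)
    have hc := tightCover_mul_left (hZf f hf) y
    rw [mul_eq_of_idem_le hyf hyi] at hc
    refine mem_tightClosure_of_cover ?_ hc
    rintro _ ⟨z, hz, rfl⟩
    rcases hZ f hf hz with hzK | hzL
    · exact mem_tightClosure_of_isBot (hdisj y hyL z hzK) _
    · exact subset_tightClosure _ ⟨z, ⟨Set.mem_biUnion hf hz, hzL⟩, idem_mul_le z hyi⟩
  · rintro x ⟨f, ⟨-, hf⟩, hxf⟩
    exact L.lower' f hf x hxf

end TightIdeal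

/-- The complement is described by the order alone, because `IdempotentsBoolean` ties the boolean
structure to the natural order only through `≤`. -/
theorem exists_relative_complement {T : Type*} [GeneralizedBooleanAlgebra T] (e g : T) :
    ∃ d : T, (∀ u, g ≤ u → d ≤ u → e ≤ u) ∧ ∀ u, u ≤ g → u ≤ d → ∀ v, u ≤ v :=
  ⟨e \ g, fun _ h1 h2 => le_sup_sdiff.trans (sup_le h1 h2),
    fun _ h1 h2 _ => (disjoint_sdiff_self_right h1 h2).trans bot_le⟩

/-! ### The tight completion: distributivity, and when its idempotents form a boolean algebra. -/

namespace TightCompletion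

theorem ext_iff_val {A B : TightCompletion S} : A = B ↔ A.val = B.val :=
  val_injective.eq_iff.symm

theorem le_iff_carrier {A B : TightCompletion S} : A ≤ B ↔ A.val.carrier ⊆ B.val.carrier :=
  ext_iff_val.trans TightIdeal.le_iff

theorem isIdempotentElem_iff {A : TightCompletion S} :
    IsIdempotentElem A ↔ IsIdempotentElem A.val := ext_iff_val

theorem compatible_iff {A B : TightCompletion S} : Compatible A B ↔ Compatible A.val B.val :=
  and_congr ext_iff_val ext_iff_val

theorem exists_isLUB {X : Set (TightCompletion S)} (hX : X.Finite) (hc : CompatibleSet X) :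
    ∃ j, IsLUB X j ∧ j.val.carrier = tightClosure (⋃ A ∈ X, A.val.carrier) := by
  have hc' : CompatibleSet (val '' X) := by
    rintro _ ⟨A, hA, rfl⟩ _ ⟨B, hB, rfl⟩
    exact compatible_iff.1 (hc A hA B hB)
  have hj : (TightIdeal.join (val '' X) hc').carrier =
      tightClosure (⋃ A ∈ X, A.val.carrier) := by
    show tightClosure (⋃ A ∈ val '' X, A.carrier) = _
    rw [Set.biUnion_image]
  refine ⟨⟨TightIdeal.join (val '' X) hc', TightIdeal.isFiniteElement_join hc' (hX.image _) ?_⟩,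
    ⟨fun A hA => ?_, fun B hB => ?_⟩, hj⟩
  · rintro _ ⟨A, -, rfl⟩
    exact A.property
  · rw [le_iff_carrier]
    exact TightIdeal.le_iff.1 ((TightIdeal.isLUB_join _ hc').1 ⟨A, hA, rfl⟩)
  · rw [le_iff_carrier]
    refine TightIdeal.le_iff.1 ((TightIdeal.isLUB_join _ hc').2 ?_)
    rintro _ ⟨A, hA, rfl⟩
    exact TightIdeal.le_iff.2 (le_iff_carrier.1 (hB hA))

theorem carrier_of_isLUB {X : Set (TightCompletion S)} (hX : X.Finite) {j : TightCompletion S}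
    (hj : IsLUB X j) : j.val.carrier = tightClosure (⋃ A ∈ X, A.val.carrier) := by
  obtain ⟨k, hk, h⟩ := exists_isLUB hX fun A hA B hB => Compatible.of_le (hj.1 hA) (hj.1 hB)
  rw [hj.unique hk, h]

/-- This needs nothing of `S`: joins are closures of unions, and multiplying a tight covering by an
element gives a tight covering of the product. -/
theorem isDistributive (S : Type*) [InverseSemigroup S] : IsDistributive (TightCompletion S) := by
  refine ⟨fun X hX hc => (exists_isLUB hX hc).imp fun j hj => hj.1, fun X hX j hj s => ?_⟩
  have hcar := carrier_of_isLUB hX hj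
  refine ⟨⟨?_, fun B hB => ?_⟩, ⟨?_, fun B hB => ?_⟩⟩
  · rintro _ ⟨A, hA, rfl⟩
    exact mul_le_mul_left'' (hj.1 hA) s
  · rw [le_iff_carrier]
    refine TightIdeal.mul_subset fun x hx y hy => ?_
    rw [hcar] at hy
    refine B.val.closure_subset ?_ (tightClosure_mul_left hx hy)
    rintro _ ⟨a, ha, b, hb, rfl⟩
    obtain ⟨A, hA, hb⟩ := Set.mem_iUnion₂.1 hb
    exact le_iff_carrier.1 (hB ⟨A, hA, rfl⟩) (TightIdeal.mem_mul ha hb)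
  · rintro _ ⟨A, hA, rfl⟩
    exact mul_le_mul_right'' (hj.1 hA) s
  · rw [le_iff_carrier]
    refine TightIdeal.mul_subset fun y hy x hx => ?_
    rw [hcar] at hy
    refine B.val.closure_subset ?_ (tightClosure_mul_right hy hx)
    rintro _ ⟨b, hb, a, ha, rfl⟩
    obtain ⟨A, hA, hb⟩ := Set.mem_iUnion₂.1 hb
    exact le_iff_carrier.1 (hB ⟨A, hA, rfl⟩) (TightIdeal.mem_mul hb ha)

theorem exists_idem_join {X : Set (TightCompletion S)} (hX : X.Finite)
    (h : ∀ A ∈ X, IsIdempotentElem A) : ∃ j : TightCompletion S, IsIdempotentElem j ∧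
      j.val.carrier = tightClosure (⋃ A ∈ X, A.val.carrier) := by
  obtain ⟨j, -, hj⟩ := exists_isLUB hX fun A hA B hB => compatible_of_idem (h A hA) (h B hB)
  refine ⟨j, isIdempotentElem_iff.2 (TightIdeal.isIdempotentElem_iff.2 fun x hx => ?_), hj⟩
  rw [hj] at hx
  obtain ⟨Y, hY, hx⟩ := hx
  refine idem_of_cover hx fun y hy => ?_
  obtain ⟨A, hA, hyA⟩ := Set.mem_iUnion₂.1 (hY hy)
  exact TightIdeal.idem_elem (isIdempotentElem_iff.1 (h A hA)) hyA

theorem exists_idem_join_pair {E F : TightCompletion S} (hE : IsIdempotentElem E)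
    (hF : IsIdempotentElem F) : ∃ j : TightCompletion S, IsIdempotentElem j ∧
      j.val.carrier = tightClosure (E.val.carrier ∪ F.val.carrier) := by
  have := exists_idem_join (X := {E, F}) (Set.toFinite _) (by
    rintro _ (rfl | rfl)
    exacts [hE, hF])
  rwa [Set.biUnion_pair] at this

theorem exists_idem_bot (S : Type*) [InverseSemigroup S] :
    ∃ j : TightCompletion S, IsIdempotentElem j ∧ j.val.carrier = tightClosure ∅ := by
  have := exists_idem_join (S := S) Set.finite_empty (by simp)
  rwa [Set.biUnion_empty] at this

theorem idempotentsBoolean (hR : HasTightComplements (TightQuotient S)) :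
    IdempotentsBoolean (TightCompletion S) := by
  let T := {e : TightCompletion S // IsIdempotentElem e}
  let car : T → Set (TightQuotient S) := fun e => e.1.val.carrier
  have hle : ∀ e f : T, e ≤ f ↔ car e ⊆ car f := fun _ _ => le_iff_carrier
  have hid : ∀ e : T, IsIdempotentElem e.1.val := fun e => isIdempotentElem_iff.1 e.2
  have hel : ∀ e : T, ∀ x ∈ car e, IsIdempotentElem x := fun e x hx =>
    TightIdeal.idem_elem (hid e) hx
  have hcl : ∀ e : T, tightClosure (car e) = car e := fun e => e.1.val.tightClosure_carrier
  have hinj : ∀ e f : T, car e = car f → e = f := fun e f h =>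
    le_antisymm ((hle e f).2 h.le) ((hle f e).2 h.ge)
  have hsup : ∀ e f : T, ∃ g : T, car g = tightClosure (car e ∪ car f) := fun e f => by
    obtain ⟨j, hji, hj⟩ := exists_idem_join_pair e.2 f.2
    exact ⟨⟨j, hji⟩, hj⟩
  have hinf : ∀ e f : T, ∃ g : T, car g = car e ∩ car f := fun e f =>
    ⟨⟨e.1 * f.1, idem_mul e.2 f.2⟩, TightIdeal.carrier_mul_of_idem (hid e) (hid f)⟩
  have hbot : ∃ g : T, car g = tightClosure ∅ := by
    obtain ⟨j, hji, hj⟩ := exists_idem_bot S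
    exact ⟨⟨j, hji⟩, hj⟩
  have hcov : ∀ e f : T, car e ⊆
      tightClosure (car e ∩ car f ∪ (TightIdeal.sdiff e.1.val f.1.val).carrier) := fun e f =>
    TightIdeal.subset_tightClosure_sdiff hR (hid e) (hid f) f.1.property
  have hsd : ∀ e f : T, ∃ g : T, car g = (TightIdeal.sdiff e.1.val f.1.val).carrier :=
    fun e f => ⟨⟨⟨TightIdeal.sdiff e.1.val f.1.val,
      TightIdeal.isFiniteElement_of_cover (hid e) e.1.property (hcov e f) (fun x hx => hx.1)
        fun l hl k hk => hl.2 k hk.2⟩,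
      isIdempotentElem_iff.2 (TightIdeal.isIdempotentElem_iff.2 fun x hx => hel e x hx.1)⟩, rfl⟩
  -- The operations are used only through their carriers, so the axioms become statements about
  -- closures, unions and intersections.
  choose sup hsup using hsup
  choose inf hinf using hinf
  choose sd hsd using hsd
  obtain ⟨bot, hbot⟩ := hbot
  refine ⟨{ (inferInstance : PartialOrder T) with
    sup := sup
    inf := inf
    sdiff := sd
    bot := bot
    le_sup_left := fun e f => (hle _ _).2 ?_
    le_sup_right := fun e f => (hle _ _).2 ?_
    sup_le := fun e f g he hf => (hle _ _).2 ?_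
    inf_le_left := fun e f => (hle _ _).2 ?_
    inf_le_right := fun e f => (hle _ _).2 ?_
    le_inf := fun e f g hf hg => (hle _ _).2 ?_
    le_sup_inf := fun e f g => (hle _ _).2 ?_
    sup_inf_sdiff := fun e f => hinj _ _ ?_
    inf_inf_sdiff := fun e f => hinj _ _ ?_ }, fun _ _ => Iff.rfl⟩
  · rw [hsup]
    exact Set.subset_union_left.trans (subset_tightClosure _)
  · rw [hsup]
    exact Set.subset_union_right.trans (subset_tightClosure _)
  · rw [hsup, ← hcl g, tightClosure_subset_iff, hcl g]
    exact Set.union_subset ((hle _ _).1 he) ((hle _ _).1 hf)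
  · rw [hinf]
    exact Set.inter_subset_left
  · rw [hinf]
    exact Set.inter_subset_right
  · rw [hinf]
    exact Set.subset_inter ((hle _ _).1 hf) ((hle _ _).1 hg)
  · show car (inf (sup e f) (sup e g)) ⊆ car (sup e (inf f g))
    rw [hinf, hsup, hsup, hsup, hinf]
    rintro x ⟨⟨X, hX, hXx⟩, Y, hY, hYx⟩
    have hxi : IsIdempotentElem x :=
      idem_of_cover hXx fun y hy => (hX hy).elim (hel e y) (hel f y)
    -- The idempotent `x = x * x` is covered by `X * Y`, and each product lies in `e` or in both `f`
    -- and `g`.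
    have hc := tightCover_mul hXx hYx
    rw [hxi.eq] at hc
    refine ⟨X * Y, ?_, hc⟩
    rintro _ ⟨a, ha, b, hb, rfl⟩
    have hai : IsIdempotentElem a := (hX ha).elim (hel e a) (hel f a)
    have hbi : IsIdempotentElem b := (hY hb).elim (hel e b) (hel g b)
    rcases hX ha with ha | ha
    · exact Or.inl (e.1.val.lower' a ha _ (mul_idem_le a hbi))
    rcases hY hb with hb | hb
    · exact Or.inl (e.1.val.lower' b hb _ (idem_mul_le b hai))
    · exact Or.inr ⟨f.1.val.lower' a ha _ (mul_idem_le a hbi),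
        g.1.val.lower' b hb _ (idem_mul_le b hai)⟩
  · show car (sup (inf e f) (sd e f)) = car e
    rw [hsup, hinf, hsd]
    refine Set.Subset.antisymm ?_ (hcov e f)
    rw [← hcl e, tightClosure_subset_iff, hcl e]
    exact Set.union_subset Set.inter_subset_left fun x hx => hx.1
  · show car (inf (inf e f) (sd e f)) = car bot
    rw [hinf, hinf, hsd, hbot]
    refine Set.Subset.antisymm ?_ ?_
    · rintro x ⟨⟨hxe, hxf⟩, -, hx⟩
      have := hx x hxf
      rw [(hel e x hxe).eq] at this
      exact mem_tightClosure_of_isBot this _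
    · rintro x ⟨X, hX, hx⟩
      have hxb : IsBot x := isBot_of_cover hx fun y hy => (hX hy).elim
      have h : ∀ A : TightIdeal (TightQuotient S), x ∈ A.carrier := fun A =>
        A.closure_subset (Set.empty_subset _) (mem_tightClosure_of_isBot hxb _)
      exact ⟨⟨h _, h _⟩, h _⟩

theorem hasTightComplements_quotient (hB : IdempotentsBoolean (TightCompletion S)) :
    HasTightComplements (TightQuotient S) := by
  obtain ⟨B, hB⟩ := hB
  refine hasTightComplements_of_idem fun e g he hg hge => ?_
  let T := {e : TightCompletion S // IsIdempotentElem e}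
  let E : T := ⟨⟨TightIdeal.principal e, TightIdeal.isFiniteElement_principal e⟩,
    isIdempotentElem_iff.2 (TightIdeal.isIdempotentElem_principal he)⟩
  let G : T := ⟨⟨TightIdeal.principal g, TightIdeal.isFiniteElement_principal g⟩,
    isIdempotentElem_iff.2 (TightIdeal.isIdempotentElem_principal hg)⟩
  obtain ⟨D, hDsup, hDinf⟩ : ∃ D : T, (∀ U : T, G.1 ≤ U.1 → D.1 ≤ U.1 → E.1 ≤ U.1) ∧
      ∀ U : T, U.1 ≤ G.1 → U.1 ≤ D.1 → ∀ V : T, U.1 ≤ V.1 := by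
    simp only [← hB]
    exact @exists_relative_complement _ B E G
  obtain ⟨j, hji, hj⟩ := exists_idem_join_pair G.2 D.2
  obtain ⟨b, hbi, hb⟩ := exists_idem_bot S
  have hEj := hDsup ⟨j, hji⟩
    (le_iff_carrier.2 (by rw [hj]; exact Set.subset_union_left.trans (subset_tightClosure _)))
    (le_iff_carrier.2 (by rw [hj]; exact Set.subset_union_right.trans (subset_tightClosure _)))
  have hej : e ∈ tightClosure (G.1.val.carrier ∪ D.1.val.carrier) := by
    rw [← hj]
    exact le_iff_carrier.1 hEj (TightIdeal.mem_principal_self e)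
  -- Covering elements from the principal ideal are refined to elements below `g`, which `g` itself
  -- can then replace.
  have hej' : e ∈ tightClosure (Set.Iic g ∪ D.1.val.carrier) := by
    refine tightClosure_subset_iff.2 (Set.union_subset ?_ ?_) hej
    · exact tightClosure_mono Set.subset_union_left
    · exact Set.subset_union_right.trans (subset_tightClosure _)
  obtain ⟨Y, hY, hYe⟩ := hej'
  refine ⟨Y ∩ D.1.val.carrier, ?_, (hYe.1.inter_of_left _).insert g, ?_, ?_⟩
  · rintro x ⟨-, hx⟩ u hux hug
    have hu : IsIdempotentElem u := idem_of_le hug hg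
    -- The principal ideal of `u` lies below both `g`'s ideal and its complement, hence below the
    -- least ideal, the closure of the empty set; so `u` is zero.
    have h := hDinf
      ⟨⟨TightIdeal.principal u, TightIdeal.isFiniteElement_principal u⟩,
        isIdempotentElem_iff.2 (TightIdeal.isIdempotentElem_principal hu)⟩
      (le_iff_carrier.2 (TightIdeal.le_iff.1 (TightIdeal.principal_le
        (G.1.val.lower' g (TightIdeal.mem_principal_self g) u hug))))
      (le_iff_carrier.2 (TightIdeal.le_iff.1 (TightIdeal.principal_le
        (D.1.val.lower' x hx u hux))))
      ⟨b, hbi⟩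
    have hub := le_iff_carrier.1 h (TightIdeal.mem_principal_self u)
    rw [hb] at hub
    obtain ⟨X, hX, hXu⟩ := hub
    exact isBot_of_cover hXu fun y hy => (hX hy).elim
  · rintro x (rfl | ⟨hx, -⟩)
    exacts [hge, hYe.2.1 x hx]
  · intro z hz hz0
    obtain ⟨y, hy, u, hu0, huz, huy⟩ := hYe.2.2 z hz hz0
    rcases hY hy with hyg | hyD
    · exact ⟨g, Set.mem_insert _ _, u, hu0, huz, huy.trans hyg⟩
    · exact ⟨y, Or.inr ⟨hy, hyD⟩, u, hu0, huz, huy⟩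

theorem isWeaklyBoolean_iff :
    IsWeaklyBoolean (TightCompletion S) ↔ HasTightComplements (TightQuotient S) :=
  ⟨fun h => hasTightComplements_quotient h.2, fun h => ⟨isDistributive S, idempotentsBoolean h⟩⟩

end TightCompletion

/-! ### Tight complements in `S` and in its quotient by `≡`. -/

theorem tightMk_mul_inv_mul_of_le {x : TightQuotient S} {a e : S} (h : x ≤ tightMk a)
    (he : tightMk e = x⁻¹ * x) : tightMk (a * e) = x := by
  rw [map_mul, he, ← le_def.1 h]

theorem exists_lift_le {x : TightQuotient S} {a : S} (h : x ≤ tightMk a) :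
    ∃ y ≤ a, tightMk y = x := by
  obtain ⟨e, he, hex⟩ := exists_idem_lift (idem_inv_mul x)
  exact ⟨a * e, mul_idem_le a he, tightMk_mul_inv_mul_of_le h hex⟩

theorem tightCover_image_tightMk {z a : S} (hz : IsBot z) {X : Set S} (hX : X ∈ tightCover a) :
    tightMk '' X ∈ tightCover (tightMk a) := by
  refine ⟨hX.1.image _, ?_, ?_⟩
  · rintro _ ⟨x, hx, rfl⟩
    exact tightMk_mono (hX.2.1 x hx)
  · intro w hw hw0
    obtain ⟨v, hva, rfl⟩ := exists_lift_le hw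
    obtain ⟨b, hb, y, hy0, hyv, hyb⟩ := hX.2.2 v hva fun h => hw0 (isBot_tightMk h)
    exact ⟨_, ⟨b, hb, rfl⟩, tightMk y, fun h => hy0 (isBot_of_tightMk hz h), tightMk_mono hyv,
      tightMk_mono hyb⟩

theorem hasTightComplements_tightQuotient {z : S} (hz : IsBot z) (hS : HasTightComplements S) :
    HasTightComplements (TightQuotient S) := by
  intro a f hfa
  obtain ⟨a, rfl⟩ := tightMk_surjective a
  obtain ⟨f, hf, rfl⟩ := exists_lift_le hfa
  obtain ⟨X, hX, hc⟩ := hS a f hf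
  refine ⟨tightMk '' X, ?_, ?_⟩
  · rintro _ ⟨x, hx, rfl⟩ u hux huf
    obtain ⟨v, hvx, rfl⟩ := exists_lift_le hux
    obtain ⟨w, hwf, hwv⟩ := exists_lift_le huf
    obtain ⟨Y, hYw, hYv⟩ := tightMk_eq.1 hwv
    -- Members of a common covering of `v ≤ x` and `w ≤ f` lie below both `x` and `f`, so they are
    -- all zero.
    exact isBot_tightMk (isBot_of_cover hYv fun y hy =>
      hX x hx y ((hYv.2.1 y hy).trans hvx) ((hYw.2.1 y hy).trans hwf))
  · have := tightCover_image_tightMk hz hc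
    rwa [Set.image_insert_eq] at this

theorem hasTightComplements_of_tightQuotient {z : S} (hz : IsBot z)
    (hR : HasTightComplements (TightQuotient S)) : HasTightComplements S := by
  classical
  intro a f hfa
  obtain ⟨X, hX, hc⟩ := hR (tightMk a) (tightMk f) (tightMk_mono hfa)
  choose e he using fun x : TightQuotient S => exists_idem_lift (idem_inv_mul x)
  -- The idempotent over the class of `f` is forced to be `f⁻¹ * f`, so that the lifted covering
  -- contains `f` itself and not merely an equivalent element.
  have hcov := tightCover_lift hz hc (Function.update e (tightMk f) (f⁻¹ * f)) fun x hx => by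
    rcases eq_or_ne x (tightMk f) with rfl | h
    · rw [Function.update_self]
      exact ⟨idem_inv_mul f, by rw [map_mul, tightMk_inv]⟩
    · rw [Function.update_of_ne h]
      exact he x
  rw [Set.image_insert_eq, Function.update_self, ← le_def.1 hfa] at hcov
  by_cases hfX : tightMk f ∈ X
  · have hf0 : IsBot f := isBot_of_tightMk hz (hX _ hfX _ le_rfl le_rfl)
    exact ⟨_, fun x _ u _ huf => hf0.mono huf, hcov⟩
  · refine ⟨_, ?_, hcov⟩
    rintro _ ⟨x, hx, rfl⟩ u hux huf
    have hne : x ≠ tightMk f := fun h => hfX (h ▸ hx)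
    have hxa : x ≤ tightMk a := hc.2.1 x (Set.mem_insert_of_mem _ hx)
    beta_reduce at hux
    rw [Function.update_of_ne hne] at hux
    have h1 := tightMk_mono hux
    rw [tightMk_mul_inv_mul_of_le hxa (he x).2] at h1
    exact isBot_of_tightMk hz (hX x hx _ h1 (tightMk_mono huf))

theorem hasTightComplements_of_noBot (h0 : ∀ z : S, ¬ IsBot z) : HasTightComplements S := by
  intro a f hfa
  refine ⟨∅, by simp, ?_⟩
  rw [insert_empty_eq]
  refine ⟨Set.finite_singleton f, by rintro _ rfl; exact hfa, fun x hx _ => ?_⟩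
  exact ⟨f, rfl, _, h0 _, mul_idem_le x (idem_inv_mul f), mul_dom_le hx hfa⟩

/-- Without a zero in `S` the transfer lemmas do not apply, since the quotient may acquire a minimum
by collapsing to a point. Both sides then hold outright: in `S` every `f ≤ a` covers `a`, so
comparable elements of the quotient are equal. -/
theorem hasTightComplements_tightQuotient_iff :
    HasTightComplements (TightQuotient S) ↔ HasTightComplements S := by
  by_cases h : ∃ z : S, IsBot z
  · obtain ⟨z, hz⟩ := h
    exact ⟨hasTightComplements_of_tightQuotient hz, hasTightComplements_tightQuotient hz⟩
  · have h0 : ∀ z : S, ¬ IsBot z := fun z hz => h ⟨z, hz⟩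
    refine ⟨fun _ => hasTightComplements_of_noBot h0, fun _ a f hfa => ⟨∅, by simp, ?_⟩⟩
    obtain ⟨a, rfl⟩ := tightMk_surjective a
    obtain ⟨f, hf, rfl⟩ := exists_lift_le hfa
    have : tightMk f = tightMk a := by
      refine tightMk_eq.2 ⟨{f}, tightCover_singleton f, ?_⟩
      refine ⟨Set.finite_singleton f, by rintro _ rfl; exact hf, fun x hx _ => ?_⟩
      exact ⟨f, rfl, _, h0 _, mul_idem_le x (idem_inv_mul f), mul_dom_le hx hf⟩
    rw [this, insert_empty_eq]
    exact tightCover_singleton _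

/-! ### Restriction to the identities. -/

namespace UniversalGroupoid

theorem isUltra_of_isClosed_ultraIdentities
    (h : IsClosed (Subtype.val ⁻¹' ultraIdentities S : Set (identities S)))
    {A : UniversalGroupoid S} (hA : A.IsIdempotent) (hAt : A.IsTight) : A.IsUltra := by
  have hAi := mem_identities.2 hA
  have hmem : (⟨A, hAi⟩ : identities S) ∈
      (Subtype.val ⁻¹' ultraIdentities S : Set (identities S)) := by
    rw [← h.closure_eq, closure_subtype, Subtype.image_preimage_coe, mem_closure_iff]
    intro O hO hAO
    have hAc : A ∈ closure (ultrafilters S) := by rw [closure_ultrafilters]; exact hAt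
    -- As the identities are open, the ultrafilters approximating the idempotent filter `A` can be
    -- taken idempotent.
    obtain ⟨B, ⟨hBO, hBi⟩, hB⟩ :=
      mem_closure_iff.1 hAc _ (hO.inter isOpen_identities) ⟨hAO, hAi⟩
    exact ⟨B, hBO, hBi, mem_ultraIdentities.2 ⟨mem_identities.1 hBi, hB⟩⟩
  exact (mem_ultraIdentities.1 hmem).2

theorem preimage_ultraIdentities :
    (Subtype.val ⁻¹' ultraIdentities S : Set (identities S)) = Subtype.val ⁻¹' ultrafilters S := by
  ext A
  exact mem_ultraIdentities.trans (and_iff_right (mem_identities.1 A.2))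

end UniversalGroupoid

end InverseSemigroup

/-! ### The equivalence of the six conditions. -/

open InverseSemigroup UniversalGroupoid in
theorem theorem5p15 (S : Type*) [InverseSemigroup S] :
    List.TFAE [
      IsClosed (InverseSemigroup.UniversalGroupoid.ultrafilters S),
      ∀ A : InverseSemigroup.UniversalGroupoid S, A.IsTight → A.IsUltra,
      ∀ A : InverseSemigroup.UniversalGroupoid S, A.IsIdempotent → A.IsTight →
        A.IsIdempotent ∧ A.IsUltra,
      IsClosed (Subtype.val ⁻¹' InverseSemigroup.UniversalGroupoid.ultraIdentities S :
        Set (InverseSemigroup.UniversalGroupoid.identities S)),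
      ∀ (x : S) (t : Finset S), (∀ y ∈ t, y ≤ x) →
        IsCompact (Subtype.val ⁻¹' InverseSemigroup.UniversalGroupoid.basicSet x t :
          Set (InverseSemigroup.UniversalGroupoid.ultrafilters S)),
      InverseSemigroup.IsWeaklyBoolean (InverseSemigroup.TightCompletion S)] := by
  rw [TightCompletion.isWeaklyBoolean_iff, hasTightComplements_tightQuotient_iff]
  tfae_have 1 → 2 := fun h A hA => by
    have hA' : A ∈ closure (ultrafilters S) := by rw [closure_ultrafilters]; exact hA
    rwa [h.closure_eq] at hA'
  tfae_have 2 → 3 := fun h A hA hAt => ⟨hA, h A hAt⟩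
  tfae_have 3 → 1 := fun h => by
    refine closure_eq_iff_isClosed.1 (subset_closure.antisymm' ?_)
    rw [closure_ultrafilters]
    exact fun A hA => isUltra_of_ran (h A.ran A.ran_isIdempotent hA.ran).2
  tfae_have 1 → 4 := fun h => by
    rw [preimage_ultraIdentities]
    exact h.preimage continuous_subtype_val
  tfae_have 4 → 3 := fun h A hA hAt => ⟨hA, isUltra_of_isClosed_ultraIdentities h hA hAt⟩
  tfae_have 1 → 5 := fun h x t _ =>
    h.isClosedEmbedding_subtypeVal.isCompact_preimage (isCompact_basicSet x t)
  -- Compactness is needed only for a single excluded element.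
  tfae_have 5 → 6 := fun h => hasTightComplements_of_isCompact fun a f hfa => by
    have := (h a {f} (by simpa using hfa)).image continuous_subtype_val
    rwa [Subtype.image_preimage_coe, Set.inter_comm] at this
  tfae_have 6 → 2 := fun h A hA => hA.isUltra_of_hasTightComplements h
  tfae_finish
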